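/- Let $\Sigma$ be a finite alphabet with $0,1\in\Sigma$. Computability on $\Sigma^*$ (finite words) and $\Sigma^\omega$ (infinite sequences) is Type-2 computability. Let $\iota(a_1\ldots a_n):=11\,0a_1\,0a_2\ldots 0a_n\,011$ and $\langle w_1,\ldots,w_n\rangle:=\iota(w_1)\ldots\iota(w_n)$ for words. We say that $p\in\Sigma^\omega$ is a list of all $(w_1,\ldots,w_n)$ with property $Q$ if, for all words $w_1,\ldots,w_n$, $\iota(\langle w_1,\ldots,w_n\rangle)$ is a subword of $p$ iff $Q(w_1,\ldots,w_n)$; for single words, $p$ is a list of all $u$ with property $Q$ if, for all $u$, $\iota(u)$ is a subword of $p$ iff $Q(u)$. Let $\nu_{\mathbb Q}$ be the canonical notation of the rational numbers by words. Let $\rho_<(p)=x$ (resp. $\rho_>(p)=x$) iff $p$ is a list of all $u\in{\rm dom}(\nu_{\mathbb Q})$ with $\nu_{\mathbb Q}(u)<x$ (resp. $\nu_{\mathbb Q}(u)>x$), and let $\rho(p(0)q(0)p(1)q(1)\ldots)=x$ iff $\rho_<(p)=x$ and $\rho_>(q)=x$. A representation of a set $X$ is a partial surjective function $\delta:\subseteq\Sigma^\omega\to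 X$. For representations $\delta_1,\delta_2$ of $X$, $\delta_1\le\delta_2$ means that there is a computable partial function $h:\subseteq\Sigma^\omega\to\Sigma^\omega$ with $\delta_1(p)=\delta_2(h(p))$ for all $p\in{\rm dom}(\delta_1)$, and $\delta_1\equiv\delta_2$ means $\delta_1\le\delta_2$ and $\delta_2\le\delta_1$. Let $(\Omega,\mathcal A,\mathcal R,\alpha)$ be a computable $\sigma$-algebra: $\mathcal R$ is a countable ring of subsets of $\Omega$ with $\bigcup\mathcal R=\Omega$, $\mathcal A$ is the $\sigma$-algebra generated by $\mathcal R$, and $\alpha:\subseteq\Sigma^*\to\mathcal R$ is a partial surjective function with recursive domain such that union and set difference on $\mathcal R$ are computable on $\alpha$-names. Let $\mu$ be a computable measure on it: a measure on $\mathcal A$ that is finite on $\mathcal R$ and such that from every $\alpha$-name of $R\in\mathcal R$ one can compute a $\rho$-name of $\mu(R)$. Let $[A]:=\{B\in\mathcal A\mid\mu(A\,\Delta\,B)=0\}$ and $[\mathcal A]:=\{[A]\mid A\in\mathcal A\}$. Define $\zeta(p)=[A]$ iff $p$ is a list of all $(u,v,w)$ with $u,w\in{\rm dom}(\nu_{\mathbb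 Q})$, $v\in{\rm dom}(\alpha)$ and $$\nu_{\mathbb Q}(u)<\mu(\alpha(v)\cap A)<\nu_{\mathbb Q}(w).$$ A majorising partition for $\alpha$ is a sequence $F_0,F_1,\ldots$ of pairwise disjoint elements of $\mathcal R$ with $\mu(F_i)<\infty$ for which there are a computable function $g:\mathbb N\to\Sigma^*$ with $F_i=\alpha(g(i))$ for all $i$ and a computable partial function $g':\subseteq\Sigma^*\to\mathbb N$, defined on ${\rm dom}(\alpha)$, with $\alpha(w)\subseteq\bigcup_{i\le g'(w)}F_i$ for all $w\in{\rm dom}(\alpha)$. For such an $F$ let $$\overline d([A],[B]):=\sum_{i\in\mathbb N}\frac{\mu(F_i\cap(A\,\Delta\,B))}{1+\mu(F_i\cap(A\,\Delta\,B))}\cdot 2^{-i},$$ and let $\overline\xi_C$ be the Cauchy representation of $([\mathcal A],\overline d)$ for the notation $\beta(w):=[\alpha(w)]$ of $\{[R]\mid R\in\mathcal R\}$: $\overline\xi_C(p)=x$ iff $p=\iota(v_0)\iota(v_1)\iota(v_2)\ldots$ for words $v_i\in{\rm dom}(\alpha)$ such that $\overline d(\beta(v_i),\beta(v_j))\le 2^{-i}$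 for all $i<j$ and $\overline d(\beta(v_i),x)\to 0$. **Corollary 6.6.** If $F$ is a majorising partition for $\alpha$, then $\zeta$ and $\overline\xi_C$ are representations of $[\mathcal A]$ and $\zeta\equiv\overline\xi_C$. Hence the equivalence class of $\overline\xi_C$ does not depend on the majorising partition: if $F'$ is a further majorising partition for $\alpha$, with Cauchy representation $\overline\xi_C'$, then $\overline\xi_C\equiv\overline\xi_C'$. -/

import Mathlib

open MeasureTheory Filter Topology
open scoped symmDiff ENNReal

noncomputable section

namespace TTE

/-! ### Words, sequences and tupling -/

/-- A finite alphabet `Σ` with at least two symbols, among them `0` and `1`. -/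
abbrev Sym (k : ℕ) : Type := Fin (k + 2)

/-- `Σ^*`, the finite words. -/
abbrev Word (k : ℕ) : Type := List (Sym k)

/-- `Σ^ω`, the infinite sequences. -/
abbrev Seq (k : ℕ) : Type := ℕ → Sym k

variable {k : ℕ}

/-- The prefix of length `n` of an infinite sequence. -/
def Seq.take (p : Seq k) (n : ℕ) : Word k := (List.range n).map p

/-- The wrapping function `ι(a₁ … aₙ) = 11 0a₁ 0a₂ … 0aₙ 011`. -/
def wrap (w : Word k) : Word k := [1, 1] ++ w.flatMap (fun a => [0, a]) ++ [0, 1, 1]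

/-- The tupling function `⟨w₁, …, wₙ⟩ = ι(w₁) … ι(wₙ)` on words. -/
def tuple (ws : List (Word k)) : Word k := ws.flatMap wrap

/-- `x` is listed by `p`: the word `ι(x)` is a subword of the infinite sequence `p`. -/
def Lists (p : Seq k) (x : Word k) : Prop := ∃ n, wrap x <:+: p.take n

/-- `p` encodes the infinite sequence `v₀, v₁, …` of words: `p = ι(v₀) ι(v₁) …`. -/
def EncodesSeq (p : Seq k) (v : ℕ → Word k) : Prop :=
  ∀ n, ∃ m, p.take m = tuple ((List.range n).map v)

/-! ### Type-2 computability -/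

/-- A Type-2 machine, with a one-way input tape and a one-way output tape.
The current configuration of its finite control and its work tapes is coded by a natural number.
In every step the machine reads the next cell of the input tape (`none` is the blank,
found behind the end of a finite input word), changes its configuration and appends a finite word
to its output tape; a step is a recursive function of what the machine sees. -/
structure Machine (k : ℕ) where
  /-- The initial configuration. -/
  init : ℕ
  /-- The new configuration and the word that is written. -/
  step : ℕ → Option (Sym k) → ℕ × Word k
  computable_step : Computable₂ step

/-- The configuration and the contents of the output tape after `n` steps on input `t`. -/
def Machine.run (M : Machine k) (t : ℕ → Option (Sym k)) : ℕ → ℕ × Word k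
  | 0 => (M.init, [])
  | n + 1 =>
    ((M.step (M.run t n).1 (t n)).1, (M.run t n).2 ++ (M.step (M.run t n).1 (t n)).2)

/-- On input tape `t` the machine writes the infinite sequence `q`: at any time the output tape
holds a prefix of `q`, and every prefix of `q` is exceeded at some time. -/
def Machine.Writes (M : Machine k) (t : ℕ → Option (Sym k)) (q : Seq k) : Prop :=
  (∀ n, (M.run t n).2 = q.take (M.run t n).2.length) ∧ ∀ m, ∃ n, m ≤ (M.run t n).2.length

/-- The input tape that holds an infinite sequence. -/
def seqTape (p : Seq k) : ℕ → Option (Sym k) := fun n => some (p n)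

/-- The input tape that holds a finite word, followed by blanks. -/
def wordTape (w : Word k) : ℕ → Option (Sym k) := fun n => w[n]?

/-! ### Representations -/

/-- The graph of a naming system of `X` by infinite sequences: `δ p x` means `δ(p) = x`. -/
abbrev Rep (k : ℕ) (X : Type*) : Type _ := Seq k → X → Prop

/-- `δ` is a representation of `X`: a partial surjective function from `Σ^ω` to `X`. -/
def IsRepresentation {X : Type*} (δ : Rep k X) : Prop :=
  (∀ p x y, δ p x → δ p y → x = y) ∧ ∀ x, ∃ p, δ p x

/-- `δ₁ ≤ δ₂`: some Type-2 machine translates `δ₁`-names to `δ₂`-names. -/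
def Reducible {X : Type*} (δ₁ δ₂ : Rep k X) : Prop :=
  ∃ M : Machine k, ∀ p x, δ₁ p x → ∃ q, M.Writes (seqTape p) q ∧ δ₂ q x

/-- `δ₁ ≡ δ₂`. -/
def Equivalent {X : Type*} (δ₁ δ₂ : Rep k X) : Prop := Reducible δ₁ δ₂ ∧ Reducible δ₂ δ₁

/-! ### Natural, rational and real numbers -/

/-- The binary notation of the natural numbers (leading zeros are allowed). -/
def natNot (w : Word k) (n : ℕ) : Prop :=
  (∀ a ∈ w, a = 0 ∨ a = 1) ∧ n = w.foldl (fun m a => 2 * m + (a : ℕ)) 0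

/-- The notation `ν_ℚ` of the rational numbers (as a graph): `⟨x, y, z⟩` is a name of
`(a - b) / c` if `x, y, z` are binary names of `a`, `b` and `c ≠ 0`. -/
def ratNot (u : Word k) (r : ℚ) : Prop :=
  ∃ x y z : Word k, ∃ a b c : ℕ, u = tuple [x, y, z] ∧ natNot x a ∧ natNot y b ∧ natNot z c ∧
    c ≠ 0 ∧ r = ((a : ℚ) - b) / c

/-- `ρ_<(p) = x`: `p` is a list of all (names of) rational numbers below `x`. -/
def rhoLower : Rep k ℝ := fun p x => ∀ u, Lists p u ↔ ∃ r : ℚ, ratNot u r ∧ (r : ℝ) < x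

/-- `ρ_>(p) = x`: `p` is a list of all (names of) rational numbers above `x`. -/
def rhoUpper : Rep k ℝ := fun p x => ∀ u, Lists p u ↔ ∃ r : ℚ, ratNot u r ∧ x < (r : ℝ)

/-- `ρ⟨p, q⟩ = x` iff `ρ_<(p) = x` and `ρ_>(q) = x`, where `⟨p, q⟩ = p(0) q(0) p(1) q(1) …`. -/
def rho : Rep k ℝ := fun s x =>
  rhoLower (fun n => s (2 * n)) x ∧ rhoUpper (fun n => s (2 * n + 1)) x

/-! ### The Cauchy representation -/

/-- The Cauchy representation for the distance `d` and the notation `ν` of a dense subset. -/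
def cauchyRep {X : Type*} (d : X → X → ℝ) (ν : Word k →. X) : Rep k X := fun p x =>
  ∃ (v : ℕ → Word k) (y : ℕ → X), EncodesSeq p v ∧ (∀ i, y i ∈ ν (v i)) ∧
    (∀ i j, i < j → d (y i) (y j) ≤ (2 : ℝ)⁻¹ ^ i) ∧ Tendsto (fun i => d (y i) x) atTop (𝓝 0)

/-! ### Computable measures on computable σ-algebras -/

/-- A computable σ-algebra `(Ω, 𝒜, ℛ, α)`, where `𝒜` is the σ-algebra carried by `Ω`. -/
structure ComputableSigmaAlgebra (k : ℕ) (Ω : Type*) [MeasurableSpace Ω] where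
  /-- The ring `ℛ`. -/
  ring : Set (Set Ω)
  /-- The notation `α :⊆ Σ^* → ℛ`. -/
  nota : Word k →. Set Ω
  isSetRing : IsSetRing ring
  countable_ring : ring.Countable
  sUnion_ring : ⋃₀ ring = Set.univ
  generateFrom_ring : ‹MeasurableSpace Ω› = MeasurableSpace.generateFrom ring
  mem_ring_iff : ∀ R, R ∈ ring ↔ ∃ w, R ∈ nota w
  recursive_dom : ComputablePred fun w => (nota w).Dom
  computable_union : ∃ f : Word k × Word k →. Word k, Partrec f ∧
    ∀ u v A B, A ∈ nota u → B ∈ nota v → ∃ w ∈ f (u, v), A ∪ B ∈ nota w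
  computable_sdiff : ∃ f : Word k × Word k →. Word k, Partrec f ∧
    ∀ u v A B, A ∈ nota u → B ∈ nota v → ∃ w ∈ f (u, v), A \ B ∈ nota w

variable {Ω : Type*} [MeasurableSpace Ω]

theorem ComputableSigmaAlgebra.measurableSet_of_mem_ring (S : ComputableSigmaAlgebra k Ω)
    {R : Set Ω} (hR : R ∈ S.ring) : MeasurableSet R := by
  have h : MeasurableSet[MeasurableSpace.generateFrom S.ring] R :=
    MeasurableSpace.measurableSet_generateFrom hR
  exact S.generateFrom_ring.symm.le R h

/-- `μ` is a computable measure: it is finite on the ring and `(α, ρ)`-computable there. -/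
def IsComputableMeasure (S : ComputableSigmaAlgebra k Ω) (μ : Measure Ω) : Prop :=
  (∀ R ∈ S.ring, μ R < ∞) ∧
    ∃ M : Machine k, ∀ w, ∀ R ∈ S.nota w, ∃ q, M.Writes (wordTape w) q ∧ rho q (μ.real R)

/-- `A ∼ B` iff `μ(A ∆ B) = 0`, on the measurable sets. -/
def essSetoid (μ : Measure Ω) : Setoid {A : Set Ω // MeasurableSet A} where
  r A B := μ (A.1 ∆ B.1) = 0
  iseqv :=
    { refl := fun A => by simp
      symm := fun {A B} h => by rwa [symmDiff_comm]
      trans := fun {A B C} h h' => by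
        rw [measure_symmDiff_eq_zero_iff] at *
        exact h.trans h' }

/-- `[𝒜]`, the set of classes of measurable sets modulo null sets. -/
abbrev Classes (μ : Measure Ω) : Type _ := Quotient (essSetoid μ)

/-- `μ(R ∩ A)` as a function of the class `[A]`. -/
def interMeasure (μ : Measure Ω) (R : Set Ω) (x : Classes μ) : ℝ :=
  Quotient.lift (fun A : {A : Set Ω // MeasurableSet A} => μ.real (R ∩ A.1))
    (fun A B h => by
      have h' : A.1 =ᵐ[μ] B.1 := measure_symmDiff_eq_zero_iff.1 h
      exact measureReal_congr ((ae_eq_refl R).inter h')) x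

/-- `ζ(p) = [A]`: `p` is a list of all `⟨u, v, w⟩` such that
`ν_ℚ(u) < μ(α(v) ∩ A) < ν_ℚ(w)`. -/
def zeta (S : ComputableSigmaAlgebra k Ω) (μ : Measure Ω) : Rep k (Classes μ) := fun p x =>
  ∀ u v w, Lists p (tuple [u, v, w]) ↔
    ∃ (a b : ℚ) (R : Set Ω), ratNot u a ∧ R ∈ S.nota v ∧ ratNot w b ∧
      (a : ℝ) < interMeasure μ R x ∧ interMeasure μ R x < (b : ℝ)

/-! ### Partitions and the metric defined by a partition -/

/-- `F` is a partition for the notation `α` of the ring. -/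
def IsPartition (S : ComputableSigmaAlgebra k Ω) (μ : Measure Ω) (F : ℕ → Set Ω) : Prop :=
  (∃ g : ℕ → Word k, Computable g ∧ ∀ i, F i ∈ S.nota (g i)) ∧
    (∀ i j, i ≠ j → F i ∩ F j = ∅) ∧ ∀ i, μ (F i) < ∞

/-- `F` is a majorising partition for the notation `α` of the ring. -/
def IsMajorisingPartition (S : ComputableSigmaAlgebra k Ω) (μ : Measure Ω) (F : ℕ → Set Ω) :
    Prop :=
  IsPartition S μ F ∧ ∃ g' : Word k →. ℕ, Partrec g' ∧
    ∀ w, ∀ R ∈ S.nota w, ∃ n ∈ g' w, R ⊆ ⋃ i ≤ n, F i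

/-- `d̄([A],[B]) = ∑ᵢ μ(Fᵢ ∩ (A ∆ B)) / (1 + μ(Fᵢ ∩ (A ∆ B))) · 2⁻ⁱ`. -/
def dbar (μ : Measure Ω) (F : ℕ → Set Ω) (x y : Classes μ) : ℝ :=
  Quotient.lift₂
    (fun A B : {A : Set Ω // MeasurableSet A} =>
      ∑' i, μ.real (F i ∩ (A.1 ∆ B.1)) / (1 + μ.real (F i ∩ (A.1 ∆ B.1))) * (2 : ℝ)⁻¹ ^ i)
    (fun A B A' B' h h' => by
      have h₁ : A.1 =ᵐ[μ] A'.1 := measure_symmDiff_eq_zero_iff.1 h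
      have h₂ : B.1 =ᵐ[μ] B'.1 := measure_symmDiff_eq_zero_iff.1 h'
      have key : ∀ i, μ.real (F i ∩ (A.1 ∆ B.1)) = μ.real (F i ∩ (A'.1 ∆ B'.1)) := fun i =>
        measureReal_congr ((ae_eq_refl (F i)).inter (ae_eq_set_symmDiff h₁ h₂))
      simp only [key]) x y

/-- The notation `β(w) = [α(w)]` of `[ℛ]`. -/
def beta (S : ComputableSigmaAlgebra k Ω) (μ : Measure Ω) : Word k →. Classes μ := fun w =>
  ⟨(S.nota w).Dom, fun h => Quotient.mk (essSetoid μ) ⟨(S.nota w).get h,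
    S.measurableSet_of_mem_ring ((S.mem_ring_iff _).2 ⟨w, Part.get_mem h⟩)⟩⟩

/-- The Cauchy representation `ξ̄_C` of `([𝒜], d̄, [ℛ], β)` for the partition `F`. -/
def xiBar (S : ComputableSigmaAlgebra k Ω) (μ : Measure Ω) (F : ℕ → Set Ω) :
    Rep k (Classes μ) :=
  cauchyRep (dbar μ F) (beta S μ)

end TTE

end

namespace TTE

/-! ### Closure properties of computable functions -/

section

variable {α β γ : Type*} [Primcodable α] [Primcodable β] [Primcodable γ]

/-! The proof turns on one property of a representation `δ` of the classes, `ConfirmsMeasures`: from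
a `δ`-name of `[A]` and a name of a ring element `R`, rational bounds on both sides of `μ(R ∩ A)`
can be confirmed from finite prefixes. Both representations have this property, and any
representation having it reduces to both; all the equivalences follow.

For `ζ` the property is immediate, since a name lists such bounds (`confirmsMeasures_zeta`). For
`ξ̄_C`, the majorising function gives `n` with `R` covered by `F₀, …, Fₙ`. If the `j`-th entry of
the name denotes `Q` and `j > n`, then `μ(R ∩ A)` differs from `μ(R ∩ Q)` by at most `2^(n+2)/2^j`,
and `μ(R ∩ Q)` is computable (`interMeasure_le_add`, `confirmsMeasures_xiBar`).

Conversely, confirmable bounds can be listed, which gives a `ζ`-name (`reducible_zeta`). To obtain a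
Cauchy name, search for each `i` a ring element `R` that is close to `A` on the first `i + 3` sets
of the partition (`reducible_xiBar`). Closeness is confirmable because `μ(F ∩ (R ∆ A)) = μ(F ∩ R) +
μ((F \ R) ∩ A) - μ(F ∩ R ∩ A)`, and the search succeeds because a generating ring is dense for a
finite measure.

`ζ` is single-valued because the numbers `μ(R ∩ A)` determine `[A]` (`eq_of_interMeasure_eq`). For
`ξ̄_C`, uniqueness and surjectivity are transported along the reductions. -/

/-- `Computable`, as a function property known to `fun_prop`. -/
@[fun_prop]
def Comp (f : α → β) : Prop := Computable f

namespace Comp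

@[fun_prop]
theorem id : Comp fun a : α => a := Computable.id

@[fun_prop]
theorem const (b : β) : Comp fun _ : α => b := Computable.const b

@[fun_prop]
theorem comp {f : β → γ} {g : α → β} (hf : Comp f) (hg : Comp g) : Comp fun a => f (g a) :=
  Computable.comp hf hg

@[fun_prop]
theorem fst {f : α → β × γ} (hf : Comp f) : Comp fun a => (f a).1 := Computable.fst.comp hf

@[fun_prop]
theorem snd {f : α → β × γ} (hf : Comp f) : Comp fun a => (f a).2 := Computable.snd.comp hf

@[fun_prop]
theorem pair {f : α → β} {g : α → γ} (hf : Comp f) (hg : Comp g) : Comp fun a => (f a, g a) :=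
  Computable.pair hf hg

@[fun_prop]
theorem nat_add {f g : α → ℕ} (hf : Comp f) (hg : Comp g) : Comp fun a => f a + g a :=
  Primrec.nat_add.to_comp.comp hf hg

@[fun_prop]
theorem nat_sub {f g : α → ℕ} (hf : Comp f) (hg : Comp g) : Comp fun a => f a - g a :=
  Primrec.nat_sub.to_comp.comp hf hg

@[fun_prop]
theorem nat_mul {f g : α → ℕ} (hf : Comp f) (hg : Comp g) : Comp fun a => f a * g a :=
  Primrec.nat_mul.to_comp.comp hf hg

@[fun_prop]
theorem nat_pow {f g : α → ℕ} (hf : Comp f) (hg : Comp g) : Comp fun a => f a ^ g a :=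
  (Primrec₂.unpaired'.1 Nat.Primrec.pow).to_comp.comp hf hg

@[fun_prop]
theorem list_append {f g : α → List β} (hf : Comp f) (hg : Comp g) : Comp fun a => f a ++ g a :=
  Computable.list_append.comp hf hg

@[fun_prop]
theorem list_cons {f : α → β} {g : α → List β} (hf : Comp f) (hg : Comp g) :
    Comp fun a => f a :: g a :=
  Computable.list_cons.comp hf hg

@[fun_prop]
theorem list_length {f : α → List β} (hf : Comp f) : Comp fun a => (f a).length :=
  Computable.list_length.comp hf

@[fun_prop]
theorem list_getElem? {f : α → List β} {g : α → ℕ} (hf : Comp f) (hg : Comp g) :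
    Comp fun a => (f a)[g a]? :=
  Computable.list_getElem?.comp hf hg

@[fun_prop]
theorem list_take {f : α → List β} {g : α → ℕ} (hf : Comp f) (hg : Comp g) :
    Comp fun a => (f a).take (g a) :=
  Primrec.list_take.to_comp.comp hg hf

end Comp

/-! ### Recursively enumerable predicates -/

theorem _root_.REPred.of_bool {p : α → Prop} {f : α × ℕ → Bool} (hf : Comp f)
    (h : ∀ a, p a ↔ ∃ n, f (a, n) = true) : REPred p := by
  have h1 : Partrec fun a => Nat.rfind fun n => Part.some (f (a, n)) :=
    Partrec.rfind (p := fun a n => Part.some (f (a, n))) (Computable.partrec hf)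
  refine h1.dom_re.of_eq fun a => ?_
  rw [h]
  refine Nat.rfind_dom'.trans ?_
  constructor
  · rintro ⟨n, hn, -⟩
    exact ⟨n, by simpa using hn⟩
  · rintro ⟨n, hn⟩
    exact ⟨n, by simpa using hn, fun _ => trivial⟩

/-- Evaluating a code with a step bound makes the matrix decidable. This is what lets machines
dovetail over step counts. -/
theorem _root_.REPred.exists_bool {p : α → Prop} (h : REPred p) :
    ∃ f : α × ℕ → Bool, Comp f ∧ ∀ a, p a ↔ ∃ n, f (a, n) = true := by
  obtain ⟨c, hc⟩ := Nat.Partrec.Code.exists_code.1 (Partrec.bind_decode₂_iff.1 h)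
  refine ⟨fun x => (Nat.Partrec.Code.evaln x.2 c (Encodable.encode x.1)).isSome, ?_, fun a => ?_⟩
  · have h1 : Comp fun x : α × ℕ => ((x.2, c), Encodable.encode x.1) := by
      have : Comp (Encodable.encode : α → ℕ) := Computable.encode
      fun_prop
    exact Primrec.option_isSome.to_comp.comp
      (Nat.Partrec.Code.primrec_evaln.to_comp.comp h1)
  · have h2 : p a ↔ ∃ x, x ∈ Nat.Partrec.Code.eval c (Encodable.encode a) := by
      rw [hc]; simp
    rw [h2]
    constructor
    · rintro ⟨x, hx⟩
      obtain ⟨n, hn⟩ := Nat.Partrec.Code.evaln_complete.1 hx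
      exact ⟨n, Option.isSome_iff_exists.2 ⟨x, hn⟩⟩
    · rintro ⟨n, hn⟩
      obtain ⟨x, hx⟩ := Option.isSome_iff_exists.1 hn
      exact ⟨x, Nat.Partrec.Code.evaln_sound hx⟩

theorem _root_.REPred.comp' {p : β → Prop} (h : REPred p) {f : α → β} (hf : Comp f) :
    REPred fun a => p (f a) :=
  Partrec.comp h hf

theorem _root_.REPred.and {p q : α → Prop} (hp : REPred p) (hq : REPred q) :
    REPred fun a => p a ∧ q a := by
  have := Partrec.bind hp (g := fun a _ => Part.assert (q a) fun _ => Part.some ())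
    (Partrec.comp hq Computable.fst)
  refine (Partrec.dom_re this).of_eq fun a => ?_
  simp [Part.assert, Part.bind]

theorem _root_.REPred.exists {p : α → β → Prop} (h : REPred fun x : α × β => p x.1 x.2) :
    REPred fun a => ∃ b, p a b := by
  obtain ⟨f, hf, hp⟩ := h.exists_bool
  -- One number carries both the code of a witness and a step bound; a number that decodes to
  -- nothing counts as a failure.
  refine REPred.of_bool (f := fun x => ((Encodable.decode x.2.unpair.1 : Option β).map
    fun b => f ((x.1, b), x.2.unpair.2)).getD false) ?_ fun a => ?_
  · have h1 : Comp fun x : α × ℕ => (Encodable.decode x.2.unpair.1 : Option β) :=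
      Computable.decode.comp (Computable.fst.comp (Computable.unpair.comp Computable.snd))
    have h2 : Comp Nat.unpair := Computable.unpair
    have h3 : Comp fun y : (α × ℕ) × β => f ((y.1.1, y.2), y.1.2.unpair.2) := by fun_prop
    exact Computable.option_getD (Computable.option_map h1 (Computable.to₂ h3))
      (Computable.const false)
  · constructor
    · rintro ⟨b, hb⟩
      obtain ⟨n, hn⟩ := (hp (a, b)).1 hb
      exact ⟨Nat.pair (Encodable.encode b) n, by simpa using hn⟩
    · rintro ⟨n, hn⟩
      cases hd : (Encodable.decode n.unpair.1 : Option β) with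
      | none => simp [hd] at hn
      | some b => exact ⟨b, (hp (a, b)).2 ⟨n.unpair.2, by simpa [hd] using hn⟩⟩

/-- Run the semidecision procedures for `i = 0, 1, …` one after another: the composite halts iff all
of them do. -/
theorem _root_.REPred.forall_lt {p : α → ℕ → Prop} (h : REPred fun x : α × ℕ => p x.1 x.2)
    {N : α → ℕ} (hN : Comp N) : REPred fun a => ∀ i < N a, p a i := by
  have h1 : Partrec fun a => (Nat.rec (Part.some ())
      (fun i IH => IH.bind fun _ => Part.assert (p a i) fun _ => Part.some ()) (N a) :
        Part Unit) := by
    refine Partrec.nat_rec (f := N) (g := fun _ => Part.some ())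
      (h := fun a y => Part.assert (p a y.1) fun _ => Part.some ()) hN
      (Computable.const ()).partrec ?_
    have h2 : Comp fun x : α × ℕ × Unit => (x.1, x.2.1) := by fun_prop
    exact Partrec.comp h h2
  refine h1.dom_re.of_eq fun a => ?_
  induction N a with
  | zero => simp
  | succ n ih =>
    rw [Nat.forall_lt_succ_right, ← ih]
    simp [Part.bind, Part.assert]

theorem _root_.Partrec.graph_re {f : α →. β} (hf : Partrec f) :
    REPred fun x : α × β => x.2 ∈ f x.1 := by
  classical
  have h1 : REPred fun y : (α × β) × β => y.2 = y.1.2 :=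
    (Primrec.eq.comp (Primrec.snd) (Primrec.snd.comp Primrec.fst)).computablePred.to_re
  have h2 : Partrec fun x : α × β => (f x.1).bind fun y =>
      Part.assert (y = x.2) fun _ => Part.some () :=
    Partrec.bind (hf.comp Computable.fst) h1
  refine h2.dom_re.of_eq fun x => ?_
  rw [Part.dom_iff_mem]
  simp

theorem _root_.REPred.eq {f g : α → β} (hf : Comp f) (hg : Comp g) : REPred fun a => f a = g a := by
  classical
  have h1 : REPred fun y : β × β => y.1 = y.2 :=
    (Primrec.eq.comp Primrec.fst Primrec.snd).computablePred.to_re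
  exact h1.comp' (f := fun a => (f a, g a)) (by fun_prop)

theorem _root_.REPred.lt {f g : α → ℕ} (hf : Comp f) (hg : Comp g) : REPred fun a => f a < g a := by
  have h1 : REPred fun y : ℕ × ℕ => y.1 < y.2 :=
    (Primrec.nat_lt.comp Primrec.fst Primrec.snd).computablePred.to_re
  exact h1.comp' (f := fun a => (f a, g a)) (by fun_prop)

end

section

variable {k : ℕ} {α β γ : Type*}

/-! ### Words and sequences -/

@[simp]
theorem Seq.length_take (p : Seq k) (n : ℕ) : (p.take n).length = n := by simp [Seq.take]

theorem Seq.take_succ (p : Seq k) (n : ℕ) : p.take (n + 1) = p.take n ++ [p n] := by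
  simp [Seq.take, List.range_succ]

theorem Seq.take_take (p : Seq k) (m n : ℕ) : (p.take n).take m = p.take (min m n) := by
  simp [Seq.take, ← List.map_take, List.take_range]

theorem Seq.take_prefix (p : Seq k) {m n : ℕ} (h : m ≤ n) : p.take m <+: p.take n := by
  rw [← min_eq_left h, ← Seq.take_take]
  exact List.take_prefix _ _

theorem Seq.eq_take_of_prefix {p : Seq k} {l : Word k} {n : ℕ} (h : l <+: p.take n) :
    l = p.take l.length := by
  have h1 := List.prefix_iff_eq_take.1 h
  rw [Seq.take_take, min_eq_left] at h1
  · exact h1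
  · simpa using h.length_le

/-- Entry `i` is read off any list longer than `i`; comparability under the prefix order makes the
choice irrelevant. -/
theorem exists_limit {L : ℕ → List β} (hL : ∀ n, L n <+: L (n + 1))
    (h : ∀ m, ∃ n, m ≤ (L n).length) :
    ∃ v : ℕ → β, ∀ n, L n = (List.range (L n).length).map v := by
  have hmono : ∀ m n, m ≤ n → L m <+: L n := fun m n hmn =>
    Nat.le_induction (List.prefix_refl _) (fun n _ ih => ih.trans (hL n)) n hmn
  choose N hN using h
  refine ⟨fun i => (L (N (i + 1)))[i]'(hN (i + 1)), fun n => ?_⟩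
  refine List.ext_getElem (by simp) fun i h1 h2 => ?_
  simp only [List.getElem_map, List.getElem_range]
  rcases le_total n (N (i + 1)) with h | h
  · exact (hmono _ _ h).getElem _
  · exact ((hmono _ _ h).getElem _).symm

theorem wrap_eq (w : Word k) :
    wrap w = 1 :: 1 :: (w.flatMap (fun a => [0, a]) ++ [0, 1, 1]) := rfl

theorem wrap_eq_cons (w : Word k) : ∃ c, wrap w = 1 :: 1 :: 0 :: c := by
  cases w <;> simp [wrap_eq]

theorem tuple_append (l l' : List (Word k)) : tuple (l ++ l') = tuple l ++ tuple l' := by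
  simp [tuple]

@[simp]
theorem tuple_cons (w : Word k) (l : List (Word k)) : tuple (w :: l) = wrap w ++ tuple l := by
  simp [tuple]

@[simp]
theorem tuple_nil : tuple ([] : List (Word k)) = [] := rfl

/-- Codes are self-delimiting: after the leading `11` come pairs starting with `0`, and a pair `01`
is the terminator exactly when the next symbol is `1`. -/
theorem wrap_append_inj {x y : Word k} {r t : Word k} (h : wrap x ++ r = wrap y ++ t) :
    x = y ∧ r = t := by
  simp only [wrap_eq, List.cons_append, List.cons.injEq, true_and, List.append_assoc] at h
  induction x generalizing y with
  | nil =>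
    cases y with
    | nil => simpa using h
    | cons b y =>
      cases y <;> simp at h
  | cons a x ih =>
    cases y with
    | nil =>
      cases x <;> simp at h
    | cons b y =>
      simp only [List.flatMap_cons, List.cons_append, List.nil_append, List.cons.injEq,
        true_and] at h
      obtain ⟨h1, h2⟩ := ih h.2
      exact ⟨by rw [h.1, h1], h2⟩

theorem tuple_injective : Function.Injective (tuple : List (Word k) → Word k) := by
  intro l
  induction l with
  | nil =>
    intro l' h
    cases l' with
    | nil => rfl
    | cons w l' => simp [wrap_eq] at h
  | cons x l ih =>
    intro l' h
    cases l' with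
    | nil => simp [wrap_eq] at h
    | cons w l' =>
      simp only [tuple_cons] at h
      obtain ⟨rfl, h2⟩ := wrap_append_inj h
      rw [ih h2]

theorem tuple_prefix_tuple {l l' : List (Word k)} (h : tuple l <+: tuple l') : l <+: l' := by
  induction l generalizing l' with
  | nil => exact List.nil_prefix
  | cons x l ih =>
    obtain ⟨t, ht⟩ := h
    cases l' with
    | nil => simp [wrap_eq] at ht
    | cons w l' =>
      simp only [tuple_cons, List.append_assoc] at ht
      obtain ⟨rfl, h2⟩ := wrap_append_inj ht
      exact (List.prefix_cons_inj _).2 (ih ⟨t, h2⟩)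

theorem length_le_length_tuple (l : List (Word k)) : l.length ≤ (tuple l).length := by
  induction l with
  | nil => simp
  | cons w l ih =>
    have : (wrap w).length ≠ 0 := by simp [wrap_eq]
    simp only [tuple_cons, List.length_append, List.length_cons]
    omega

/-- The pattern `110` cannot start inside the pairs of a code. It could only straddle the end of the
terminator `011`, which the two conditions on `t` exclude. -/
theorem tail_of_body_append_eq {w t l c : Word k} (h0 : ∀ c, t ≠ 0 :: c)
    (h1 : ∀ c, t ≠ 1 :: 0 :: c)
    (h : w.flatMap (fun a => [0, a]) ++ ([0, 1, 1] ++ t) = l ++ 1 :: 1 :: 0 :: c) :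
    ∃ l', t = l' ++ 1 :: 1 :: 0 :: c := by
  induction w generalizing l with
  | nil =>
    rcases l with _ | ⟨z, _ | ⟨z', _ | ⟨z'', l⟩⟩⟩
    · simp at h
    · simp [h0] at h
    · simp [h1] at h
    · simp only [List.flatMap_nil, List.nil_append, List.cons_append, List.cons.injEq] at h
      exact ⟨l, h.2.2.2⟩
  | cons a w ih =>
    rcases l with _ | ⟨z, _ | ⟨z', l⟩⟩
    · simp at h
    · cases w <;> simp at h
    · simp only [List.flatMap_cons, List.nil_append, List.cons_append, List.cons.injEq] at h
      exact ih (by simpa using h.2.2)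

/-- Every code starts with `110`, and in a concatenation of codes this pattern occurs only where a
code starts. So an occurrence of a code is aligned, and self-delimitation identifies the word. -/
theorem mem_of_wrap_infix_tuple {x : Word k} {ws : List (Word k)} (h : wrap x <:+: tuple ws) :
    x ∈ ws := by
  obtain ⟨l, r, h⟩ := h
  induction ws generalizing l with
  | nil => simp [wrap_eq] at h
  | cons w ws ih =>
    rw [tuple_cons, List.append_assoc] at h
    obtain ⟨c, hc⟩ := wrap_eq_cons x
    rcases l with _ | ⟨z, _ | ⟨z', l⟩⟩
    · rw [List.nil_append] at h
      rw [(wrap_append_inj h).1]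
      exact List.mem_cons_self
    · cases w <;> simp [hc, wrap_eq] at h
    · refine List.mem_cons_of_mem _ ?_
      rw [hc, wrap_eq w] at h
      simp only [List.cons_append, List.cons.injEq, List.append_assoc] at h
      have ht : tuple ws = [] ∨ ∃ c, tuple ws = 1 :: 1 :: 0 :: c := by
        cases ws with
        | nil => simp
        | cons w' ws =>
          obtain ⟨c, hc⟩ := wrap_eq_cons w'
          exact Or.inr ⟨c ++ tuple ws, by simp [hc]⟩
      obtain ⟨l', hl'⟩ := tail_of_body_append_eq (t := tuple ws) (c := c ++ r)
        (by rcases ht with h | ⟨c, h⟩ <;> simp [h]) (by rcases ht with h | ⟨c, h⟩ <;> simp [h])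
        (by simpa using h.2.2.symm)
      exact ih l' (by simp [hc, hl'])

theorem exists_encodesSeq (v : ℕ → Word k) : ∃ q, EncodesSeq q v := by
  obtain ⟨q, hq⟩ := exists_limit (L := fun n => tuple ((List.range n).map v))
    (fun n => by simp [List.range_succ, tuple_append])
    (fun m => ⟨m, by simpa using length_le_length_tuple ((List.range m).map v)⟩)
  exact ⟨q, fun n => ⟨_, (hq n).symm⟩⟩

theorem EncodesSeq.exists_take_isPrefix {q : Seq k} {v : ℕ → Word k} (h : EncodesSeq q v) (n : ℕ) :
    ∃ N, q.take n <+: tuple ((List.range N).map v) := by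
  obtain ⟨m, hm⟩ := h n
  refine ⟨n, ?_⟩
  rw [← hm]
  apply Seq.take_prefix
  have := length_le_length_tuple ((List.range n).map v)
  rw [← hm] at this
  simpa using this

theorem EncodesSeq.lists_iff {q : Seq k} {v : ℕ → Word k} (h : EncodesSeq q v) (x : Word k) :
    Lists q x ↔ ∃ i, v i = x := by
  constructor
  · rintro ⟨n, hn⟩
    obtain ⟨N, hN⟩ := h.exists_take_isPrefix n
    have := mem_of_wrap_infix_tuple (hn.trans hN.isInfix)
    simp only [List.mem_map] at this
    obtain ⟨i, -, hi⟩ := this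
    exact ⟨i, hi⟩
  · rintro ⟨i, rfl⟩
    obtain ⟨m, hm⟩ := h (i + 1)
    refine ⟨m, ?_⟩
    rw [hm, List.range_succ, List.map_append, tuple_append]
    simpa using (List.suffix_append _ _).isInfix

theorem EncodesSeq.tuple_eq_take_iff {q : Seq k} {v : ℕ → Word k} (h : EncodesSeq q v)
    (l : List (Word k)) :
    (∃ n, q.take n = tuple l) ↔ l = (List.range l.length).map v := by
  constructor
  · rintro ⟨n, hn⟩
    obtain ⟨N, hN⟩ := h.exists_take_isPrefix n
    rw [hn] at hN
    have h1 := List.prefix_iff_eq_take.1 (tuple_prefix_tuple hN)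
    have h2 := (tuple_prefix_tuple hN).length_le
    rw [← List.map_take, List.take_range, min_eq_left (by simpa using h2)] at h1
    exact h1
  · intro hl
    obtain ⟨m, hm⟩ := h l.length
    exact ⟨m, by rw [hm, ← hl]⟩

/-- The cell-by-cell form survives the interleaving of two sequences in a `ρ`-name. -/
theorem lists_iff_exists_getElem? (p : Seq k) (x : Word k) :
    Lists p x ↔ ∃ i, ∀ j < (wrap x).length, (wrap x)[j]? = some (p (i + j)) := by
  constructor
  · rintro ⟨n, l, r, h⟩
    refine ⟨l.length, fun j hj => ?_⟩
    have h1 : (p.take n)[l.length + j]? = (wrap x)[j]? := by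
      rw [← h, List.append_assoc, List.getElem?_append_right (by simp),
        List.getElem?_append_left (by simpa using hj)]
      simp
    have h2 : l.length + j < n := by
      have := congrArg List.length h
      simp at this
      omega
    rw [← h1]
    simp [Seq.take, h2]
  · rintro ⟨i, h⟩
    refine ⟨i + (wrap x).length, p.take i, [], ?_⟩
    rw [List.append_nil, Seq.take, Seq.take, List.range_add, List.map_append]
    congr 1
    refine List.ext_getElem? fun j => ?_
    by_cases hj : j < (wrap x).length
    · rw [h j hj]
      simp [hj]
    · simp [hj]

end

section

variable {k : ℕ} {α β : Type*} [Primcodable α] [Primcodable β]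

/-! ### Predicates that are semidecidable relative to a sequence -/

/-- `R p a` can be confirmed effectively from finite prefixes of `p`. -/
def SemiDec (R : Seq k → α → Prop) : Prop :=
  ∃ P : Word k × α → Prop, REPred P ∧ (∀ s t a, s <+: t → P (s, a) → P (t, a)) ∧
    ∀ p a, R p a ↔ ∃ n, P (p.take n, a)

namespace SemiDec

theorem of_re {P : α → Prop} (h : REPred P) : SemiDec fun (_ : Seq k) a => P a :=
  ⟨fun x => P x.2, h.comp' (f := fun x : Word k × α => x.2) (by fun_prop), fun _ _ _ _ h => h,
    fun _ _ => by simp⟩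

theorem comp {R : Seq k → β → Prop} (h : SemiDec R) {f : α → β} (hf : Comp f) :
    SemiDec fun p a => R p (f a) := by
  obtain ⟨P, hP, hm, hR⟩ := h
  exact ⟨fun x => P (x.1, f x.2), hP.comp' (f := fun x : Word k × α => (x.1, f x.2))
    (by fun_prop), fun s t a => hm s t (f a), fun p a => hR p (f a)⟩

theorem and {R R' : Seq k → α → Prop} (h : SemiDec R) (h' : SemiDec R') :
    SemiDec fun p a => R p a ∧ R' p a := by
  obtain ⟨P, hP, hm, hR⟩ := h
  obtain ⟨P', hP', hm', hR'⟩ := h'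
  refine ⟨fun x => P x ∧ P' x, hP.and hP', fun s t a hst h => ⟨hm s t a hst h.1,
    hm' s t a hst h.2⟩, fun p a => ?_⟩
  simp only [hR, hR']
  constructor
  · rintro ⟨⟨n, hn⟩, n', hn'⟩
    exact ⟨max n n', hm _ _ _ (p.take_prefix (le_max_left _ _)) hn,
      hm' _ _ _ (p.take_prefix (le_max_right _ _)) hn'⟩
  · rintro ⟨n, hn, hn'⟩
    exact ⟨⟨n, hn⟩, n, hn'⟩

theorem exists_right {R : Seq k → α → β → Prop}
    (h : SemiDec fun p (x : α × β) => R p x.1 x.2) : SemiDec fun p a => ∃ b, R p a b := by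
  obtain ⟨P, hP, hm, hR⟩ := h
  refine ⟨fun x : Word k × α => ∃ b, P (x.1, (x.2, b)), REPred.exists
    (p := fun (x : Word k × α) b => P (x.1, (x.2, b)))
    (hP.comp' (f := fun y : (Word k × α) × β => (y.1.1, (y.1.2, y.2))) (by fun_prop)),
    fun s t a hst ⟨b, hb⟩ => ⟨b, hm s t _ hst hb⟩, fun p a => ?_⟩
  have := fun b => hR p (a, b)
  simp only at this
  simp only [this]
  exact exists_comm

/-- Finitely many confirmations fit into the longest of their prefixes, by monotonicity. -/
theorem forall_lt {R : Seq k → α → ℕ → Prop} (h : SemiDec fun p (x : α × ℕ) => R p x.1 x.2)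
    {N : α → ℕ} (hN : Comp N) : SemiDec fun p a => ∀ i < N a, R p a i := by
  obtain ⟨P, hP, hm, hR⟩ := h
  refine ⟨fun x : Word k × α => ∀ i < N x.2, P (x.1, (x.2, i)),
    REPred.forall_lt (p := fun (x : Word k × α) i => P (x.1, (x.2, i)))
    (N := fun x : Word k × α => N x.2)
    (hP.comp' (f := fun y : (Word k × α) × ℕ => (y.1.1, (y.1.2, y.2))) (by fun_prop))
    (by fun_prop), fun s t a hst h i hi => hm s t _ hst (h i hi), fun p a => ?_⟩
  have := fun b => hR p (a, b)
  simp only at this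
  simp only [this]
  constructor
  · intro h
    choose! n hn using h
    refine ⟨(Finset.range (N a)).sup n, fun i hi => hm _ _ _ (p.take_prefix ?_) (hn i hi)⟩
    exact Finset.le_sup (Finset.mem_range.2 hi)
  · rintro ⟨n, hn⟩ i hi
    exact ⟨n, hn i hi⟩

end SemiDec

/-! ### Computability of tupling and semidecidability of subword tests -/

@[fun_prop]
theorem Comp.wrap {f : α → Word k} (hf : Comp f) : Comp fun a => wrap (f a) := by
  have h1 : Primrec fun w : Word k => w.flatMap fun a => [0, a] :=
    Primrec.list_flatMap Primrec.id
      (Primrec.list_cons.comp (Primrec.const 0) (Primrec.list_cons.comp Primrec.snd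
        (Primrec.const []))).to₂
  have h2 : Comp fun w : Word k => w.flatMap fun a => [0, a] := h1.to_comp
  unfold TTE.wrap
  fun_prop

@[fun_prop]
theorem Comp.tuple {f : α → List (Word k)} (hf : Comp f) : Comp fun a => tuple (f a) := by
  have h1 : Primrec fun w : Word k => w.flatMap fun a => [0, a] :=
    Primrec.list_flatMap Primrec.id
      (Primrec.list_cons.comp (Primrec.const 0) (Primrec.list_cons.comp Primrec.snd
        (Primrec.const []))).to₂
  have h2 : Primrec (TTE.wrap : Word k → Word k) :=
    Primrec.list_append.comp (Primrec.list_append.comp (Primrec.const [1, 1]) h1)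
      (Primrec.const [0, 1, 1])
  have h3 : Comp (TTE.tuple : List (Word k) → Word k) :=
    (Primrec.list_flatMap Primrec.id (h2.comp Primrec.snd).to₂).to_comp
  fun_prop

theorem REPred.isInfix : REPred fun x : Word k × Word k => x.1 <:+: x.2 := by
  have h1 : REPred fun x : ((Word k × Word k) × Word k) × Word k => x.1.2 ++ x.1.1.1 ++ x.2 =
      x.1.1.2 := REPred.eq (by fun_prop) (by fun_prop)
  exact (REPred.exists (REPred.exists
    (p := fun (x : (Word k × Word k) × Word k) r => x.2 ++ x.1.1 ++ r = x.1.2) h1)).of_eq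
    fun _ => Iff.rfl

theorem REPred.isPrefix : REPred fun x : Word k × Word k => x.1 <+: x.2 := by
  have h1 : REPred fun x : (Word k × Word k) × Word k => x.1.1 ++ x.2 = x.1.2 :=
    REPred.eq (by fun_prop) (by fun_prop)
  exact (REPred.exists (p := fun (x : Word k × Word k) r => x.1 ++ r = x.2) h1).of_eq
    fun _ => Iff.rfl

theorem SemiDec.lists : SemiDec fun (p : Seq k) (x : Word k) => Lists p x :=
  ⟨fun x : Word k × Word k => wrap x.2 <:+: x.1, REPred.isInfix.comp'
    (f := fun x : Word k × Word k => (wrap x.2, x.1))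
    (by fun_prop), fun _ _ _ h h' => h'.trans h.isInfix, fun _ _ => Iff.rfl⟩

theorem SemiDec.tuple_eq_take :
    SemiDec fun (p : Seq k) (l : List (Word k)) => ∃ n, p.take n = tuple l := by
  refine ⟨fun x : Word k × List (Word k) => tuple x.2 <+: x.1, REPred.isPrefix.comp'
    (f := fun x : Word k × List (Word k) => (tuple x.2, x.1))
    (by fun_prop), fun _ _ _ h h' => h'.trans h, fun p l => ?_⟩
  constructor
  · rintro ⟨n, hn⟩
    exact ⟨n, by rw [hn]⟩
  · rintro ⟨n, hn⟩
    exact ⟨_, (Seq.eq_take_of_prefix hn).symm⟩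

/-! ### Machines that write encoded sequences of words -/

/-- The words written within `n` steps if `g` determines from the input read so far and the number
of words written so far which word, if any, is to be written next. -/
def written (g : Word k × ℕ → Option (Word k)) (p : Seq k) : ℕ → List (Word k)
  | 0 => []
  | n + 1 => written g p n ++ (g (p.take n, (written g p n).length)).toList

/-- The configuration stores all the input read so far and the number of words written, so time
equals the length of the known prefix. `g` is consulted before the new symbol is added. -/
theorem exists_machine_run {g : Word k × ℕ → Option (Word k)} (hg : Comp g) :
    ∃ M : Machine k, ∀ p n,
      M.run (seqTape p) n = (Encodable.encode (p.take n, (written g p n).length),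
        tuple (written g p n)) := by
  let F : (Word k × ℕ) × Sym k → ℕ × Word k := fun x =>
    ((g x.1).map fun v => (Encodable.encode (x.1.1 ++ [x.2], x.1.2 + 1), wrap v)).getD
      (Encodable.encode (x.1.1 ++ [x.2], x.1.2), [])
  have hF : Comp F := by
    have he : Comp (Encodable.encode : Word k × ℕ → ℕ) := Computable.encode
    have h1 : Comp fun x : (Word k × ℕ) × Sym k => g x.1 := by fun_prop
    have h2 : Comp fun y : ((Word k × ℕ) × Sym k) × Word k =>
        (Encodable.encode (y.1.1.1 ++ [y.1.2], y.1.1.2 + 1), wrap y.2) := by fun_prop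
    have h3 : Comp fun x : (Word k × ℕ) × Sym k =>
        (Encodable.encode (x.1.1 ++ [x.2], x.1.2), ([] : Word k)) := by fun_prop
    have h4 : Computable₂ fun (x : (Word k × ℕ) × Sym k) (v : Word k) =>
        (Encodable.encode (x.1.1 ++ [x.2], x.1.2 + 1), wrap v) := h2
    have h5 : Computable fun x : (Word k × ℕ) × Sym k => (g x.1).map fun v =>
        (Encodable.encode (x.1.1 ++ [x.2], x.1.2 + 1), wrap v) := Computable.option_map h1 h4
    exact Computable.option_getD h5 h3
  -- The default covers blanks and undecodable configurations; neither occurs on a tape holding an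
  -- infinite sequence.
  let step : ℕ → Option (Sym k) → ℕ × Word k := fun c o =>
    ((Encodable.decode c : Option (Word k × ℕ)).bind fun x => o.map fun a => F (x, a)).getD (0, [])
  have hstep : Computable₂ step := by
    have h1 : Comp fun y : ((ℕ × Option (Sym k)) × Word k × ℕ) × Sym k => F (y.1.2, y.2) := by
      fun_prop
    have h2 : Computable fun y : (ℕ × Option (Sym k)) × Word k × ℕ =>
        y.1.2.map fun a => F (y.2, a) :=
      Computable.option_map (Computable.snd.comp Computable.fst) h1.to₂
    have h3 : Computable fun x : ℕ × Option (Sym k) =>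
        (Encodable.decode x.1 : Option (Word k × ℕ)) := Computable.decode.comp Computable.fst
    exact Computable.option_getD (Computable.option_bind h3 h2.to₂) (Computable.const (0, []))
  refine ⟨⟨Encodable.encode (([], 0) : Word k × ℕ), step, hstep⟩, fun p n => ?_⟩
  induction n with
  | zero => rfl
  | succ n ih =>
    simp only [Machine.run, ih, written, step, seqTape, F, Encodable.encodek, Option.bind_some,
      Option.map_some, Option.getD_some, Seq.take_succ]
    cases g (p.take n, (written g p n).length) <;> simp [tuple_append]

/-- The machine asks for the `i`-th word only once `i` words are written, so `g` must answer at
arbitrarily late times. A word that `g` proposes at some time for every index is written at that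
time. -/
theorem exists_machine_writes {g : Word k × ℕ → Option (Word k)} (hg : Comp g) :
    ∃ M : Machine k, ∀ p : Seq k, (∀ i n, ∃ m ≥ n, (g (p.take m, i)).isSome) →
      ∃ q v, M.Writes (seqTape p) q ∧ EncodesSeq q v ∧ (∀ i, ∃ n, g (p.take n, i) = some (v i)) ∧
        ∀ n x, (∀ i, g (p.take n, i) = some x) → ∃ i, v i = x := by
  obtain ⟨M, hM⟩ := exists_machine_run hg
  refine ⟨M, fun p hp => ?_⟩
  have hpre : ∀ n, written g p n <+: written g p (n + 1) := fun n => List.prefix_append _ _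
  have hlen : ∀ i, ∃ n, i ≤ (written g p n).length := by
    intro i
    induction i with
    | zero => exact ⟨0, Nat.zero_le _⟩
    | succ i ih =>
      obtain ⟨n, hn⟩ := ih
      -- Otherwise the count stays at `i` from time `n` on, although `g` answers for `i` at a later
      -- time.
      by_contra! hcon
      have hl : ∀ m ≥ n, (written g p m).length = i := fun m hm => by
        have h1 : written g p n <+: written g p m :=
          Nat.le_induction (List.prefix_refl _) (fun n _ ih => ih.trans (hpre n)) m hm
        have := h1.length_le
        have := hcon m
        omega
      obtain ⟨m, hm, hg'⟩ := hp i n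
      obtain ⟨x, hx⟩ := Option.isSome_iff_exists.1 hg'
      have h1 := hl (m + 1) (by omega)
      rw [written, hl m hm, hx] at h1
      simp [hl m hm] at h1
  obtain ⟨v, hv⟩ := exists_limit hpre hlen
  obtain ⟨q, hq⟩ := exists_encodesSeq v
  have hrun : ∀ n, ∃ m, (M.run (seqTape p) n).2 = q.take m := fun n => by
    obtain ⟨m, hm⟩ := hq (written g p n).length
    exact ⟨m, by rw [hM, hm, ← hv]⟩
  have hinv : ∀ n i, i < (written g p n).length →
      ∃ m, g (p.take m, i) = (written g p n)[i]? := by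
    intro n
    induction n with
    | zero => simp [written]
    | succ n ih =>
      intro i hi
      rcases lt_or_ge i (written g p n).length with h | h
      · obtain ⟨m, hm⟩ := ih i h
        exact ⟨m, by rw [hm, written, List.getElem?_append_left h]⟩
      · cases hgn : g (p.take n, (written g p n).length) with
        | none => simp [written, hgn] at hi; omega
        | some x =>
          have hi' : i = (written g p n).length := by
            simp [written, hgn] at hi; omega
          subst hi'
          exact ⟨n, by simp [written, hgn]⟩
  refine ⟨q, v, ⟨fun n => ?_, fun m => ?_⟩, hq, fun i => ?_, fun n x hx => ?_⟩
  · obtain ⟨m, hm⟩ := hrun n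
    rw [hm]; simp
  · obtain ⟨n, hn⟩ := hlen m
    exact ⟨n, by rw [hM]; exact hn.trans (length_le_length_tuple _)⟩
  · obtain ⟨n, hn⟩ := hlen (i + 1)
    obtain ⟨m, hm⟩ := hinv n i hn
    refine ⟨m, ?_⟩
    rw [hm, hv]
    simp [Nat.lt_of_succ_le hn]
  · refine ⟨(written g p n).length, ?_⟩
    have h1 : written g p (n + 1) = written g p n ++ [x] := by simp [written, hx]
    have h2 := congrArg (fun l => l[(written g p n).length]?) (hv (n + 1))
    simp only [h1] at h2
    simpa using h2.symm

/-- Whatever can be confirmed from `p` can be listed from `p`. -/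
theorem SemiDec.exists_machine_lists {R : Seq k → Word k → Prop} (h : SemiDec R) :
    ∃ M : Machine k, ∀ p, ∃ q, M.Writes (seqTape p) q ∧ ∀ x, x ≠ [] → (Lists q x ↔ R p x) := by
  obtain ⟨P, hP, -, hR⟩ := h
  obtain ⟨f, hf, hfP⟩ := hP.exists_bool
  -- The time is decoded as a prefix length, a word and a step bound. The empty word is written when
  -- nothing is confirmed, which is why it is excluded from the conclusion.
  let cand : Word k × ℕ → Word k := fun y =>
    ((Encodable.decode y.1.length : Option (ℕ × Word k × ℕ)).map fun c =>
      bif f ((y.1.take c.1, c.2.1), c.2.2) then c.2.1 else []).getD []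
  have hc : Comp fun y => some (cand y) := by
    refine Computable.option_some.comp (Computable.option_getD (Computable.option_map
      (f := fun y : Word k × ℕ => (Encodable.decode y.1.length : Option (ℕ × Word k × ℕ)))
      ?_ ?_) (Computable.const []))
    · exact Computable.decode.comp (Computable.list_length.comp Computable.fst)
    · refine Computable.cond ?_ ?_ (Computable.const [])
      · have : Comp fun x : (Word k × ℕ) × ℕ × Word k × ℕ =>
          f ((x.1.1.take x.2.1, x.2.2.1), x.2.2.2) := by fun_prop
        exact this
      · have : Comp fun x : (Word k × ℕ) × ℕ × Word k × ℕ => x.2.2.1 := by fun_prop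
        exact this
  obtain ⟨M, hM⟩ := exists_machine_writes hc
  refine ⟨M, fun p => ?_⟩
  obtain ⟨q, v, hw, hq, h1, h2⟩ := hM p fun i n => ⟨n, le_rfl, rfl⟩
  refine ⟨q, hw, fun x hx => ?_⟩
  rw [hq.lists_iff, hR]
  constructor
  · rintro ⟨i, rfl⟩
    obtain ⟨n, hn⟩ := h1 i
    simp only [Option.some.injEq, cand, Seq.length_take] at hn
    cases hd : (Encodable.decode n : Option (ℕ × Word k × ℕ)) with
    | none => simp [hd] at hn; exact absurd hn.symm (by simpa using hx)
    | some c =>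
      simp only [hd, Option.map_some, Option.getD_some, Seq.take_take] at hn
      cases hfc : f ((p.take (min c.1 n), c.2.1), c.2.2) with
      | false => simp [hfc] at hn; exact absurd hn.symm (by simpa using hx)
      | true =>
        simp only [hfc, cond_true] at hn
        rw [← hn]
        exact ⟨_, (hfP _).2 ⟨_, hfc⟩⟩
  · rintro ⟨n, hn⟩
    obtain ⟨t, ht⟩ := (hfP _).1 hn
    refine h2 (Encodable.encode (n, x, t)) x fun i => ?_
    -- At the time given by the code, the prefix of length `n` has already been read.
    have hle : n ≤ Encodable.encode (n, x, t) := Nat.left_le_pair _ _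
    simp only [cand, Seq.length_take, Encodable.encodek, Option.map_some, Option.getD_some,
      Seq.take_take, min_eq_left hle, ht, cond_true]

/-- If for every `i` some word is confirmed from `p`, then a sequence of such words can be computed
from `p`. -/
theorem SemiDec.exists_machine_choice {R : Seq k → ℕ × Word k → Prop} (h : SemiDec R) :
    ∃ M : Machine k, ∀ p, (∀ i, ∃ v, R p (i, v)) →
      ∃ q v, M.Writes (seqTape p) q ∧ EncodesSeq q v ∧ ∀ i, R p (i, v i) := by
  obtain ⟨P, hP, -, hR⟩ := h
  obtain ⟨f, hf, hfP⟩ := hP.exists_bool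
  -- Only the first component of the unpaired time is decoded; the second lets every code recur at
  -- arbitrarily late times.
  let cand : Word k × ℕ → Option (Word k) := fun y =>
    (Encodable.decode y.1.length.unpair.1 : Option (ℕ × Word k × ℕ)).bind fun c =>
      bif f ((y.1.take c.1, (y.2, c.2.1)), c.2.2) then some c.2.1 else none
  have hc : Comp cand := by
    refine Computable.option_bind
      (f := fun y : Word k × ℕ => (Encodable.decode y.1.length.unpair.1 : Option (ℕ × Word k × ℕ)))
      ?_ ?_
    · exact Computable.decode.comp (Computable.fst.comp
        (Computable.unpair.comp (Computable.list_length.comp Computable.fst)))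
    · refine Computable.cond ?_ (Computable.option_some.comp ?_) (Computable.const none)
      · have : Comp fun x : (Word k × ℕ) × ℕ × Word k × ℕ =>
          f ((x.1.1.take x.2.1, (x.1.2, x.2.2.1)), x.2.2.2) := by fun_prop
        exact this
      · have : Comp fun x : (Word k × ℕ) × ℕ × Word k × ℕ => x.2.2.1 := by fun_prop
        exact this
  obtain ⟨M, hM⟩ := exists_machine_writes hc
  refine ⟨M, fun p hp => ?_⟩
  obtain ⟨q, v, hw, hq, h1, -⟩ := hM p fun i n => by
    obtain ⟨v, hv⟩ := hp i
    obtain ⟨m, hm⟩ := (hR _ _).1 hv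
    obtain ⟨t, ht⟩ := (hfP _).1 hm
    have hle : m ≤ Encodable.encode (m, v, t) := Nat.left_le_pair _ _
    have hle' := Nat.left_le_pair (Encodable.encode (m, v, t)) n
    refine ⟨Nat.pair (Encodable.encode (m, v, t)) n, Nat.right_le_pair _ _, ?_⟩
    simp only [cand, Seq.length_take, Nat.unpair_pair, Encodable.encodek, Option.bind_some,
      Seq.take_take, min_eq_left (hle.trans hle'), ht, cond_true, Option.isSome_some]
  refine ⟨q, v, hw, hq, fun i => ?_⟩
  obtain ⟨n, hn⟩ := h1 i
  simp only [cand, Seq.length_take, Seq.take_take] at hn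
  cases hd : (Encodable.decode n.unpair.1 : Option (ℕ × Word k × ℕ)) with
  | none => simp [hd] at hn
  | some c =>
    simp only [hd, Option.bind_some] at hn
    cases hfc : f ((p.take (min c.1 n), (i, c.2.1)), c.2.2) with
    | false => simp [hfc] at hn
    | true =>
      simp only [hfc, cond_true, Option.some.injEq] at hn
      rw [← hn, hR]
      exact ⟨_, (hfP _).2 ⟨_, hfc⟩⟩

end

section

variable {k : ℕ} {α β : Type*} [Primcodable α] [Primcodable β]

/-! ### Rational numbers, coded by triples of natural numbers -/

/-- A code `(a, b, c)` of the rational number `(a - b) / (c + 1)`. -/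
abbrev RatCode : Type := ℕ × ℕ × ℕ

/-- The rational number coded by a triple. -/
def RatCode.val (t : RatCode) : ℚ := ((t.1 : ℚ) - t.2.1) / (t.2.2 + 1)

/-- A code of the sum. -/
def RatCode.add (s t : RatCode) : RatCode :=
  (s.1 * (t.2.2 + 1) + t.1 * (s.2.2 + 1), s.2.1 * (t.2.2 + 1) + t.2.1 * (s.2.2 + 1),
    (s.2.2 + 1) * (t.2.2 + 1) - 1)

/-- A code of `2 ^ m / 2 ^ n`. -/
def RatCode.twoPow (m n : ℕ) : RatCode := (2 ^ m, 0, 2 ^ n - 1)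

theorem RatCode.val_add (s t : RatCode) : (s.add t).val = s.val + t.val := by
  obtain ⟨a, b, c⟩ := s
  obtain ⟨a', b', c'⟩ := t
  have h : ((((c + 1) * (c' + 1) - 1 : ℕ) : ℚ)) = (c + 1) * (c' + 1) - 1 := by
    rw [Nat.cast_sub (Nat.mul_pos c.succ_pos c'.succ_pos)]
    push_cast; ring
  have h1 : (c : ℚ) + 1 ≠ 0 := by positivity
  have h2 : (c' : ℚ) + 1 ≠ 0 := by positivity
  simp only [RatCode.val, RatCode.add, h]
  push_cast
  field_simp
  ring

theorem RatCode.val_twoPow (m n : ℕ) : (RatCode.twoPow m n).val = 2 ^ m / 2 ^ n := by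
  simp [RatCode.val, RatCode.twoPow, Nat.cast_sub (Nat.one_le_two_pow)]

theorem RatCode.exists_val_eq (r : ℚ) : ∃ t : RatCode, t.val = r := by
  refine ⟨(r.num.toNat, (-r.num).toNat, r.den - 1), ?_⟩
  have h1 : ((r.num.toNat : ℚ) - (-r.num).toNat) = r.num := by
    have := Int.toNat_sub_toNat_neg r.num
    exact_mod_cast this
  have h2 : ((r.den - 1 : ℕ) : ℚ) + 1 = r.den := by
    rw [Nat.cast_sub r.pos]; simp
  simp only [RatCode.val, h1, h2]
  exact Rat.num_div_den r

theorem RatCode.exists_between {x y : ℝ} (h : x < y) :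
    ∃ t : RatCode, x < (t.val : ℝ) ∧ (t.val : ℝ) < y := by
  obtain ⟨r, h1, h2⟩ := exists_rat_btwn h
  obtain ⟨t, rfl⟩ := RatCode.exists_val_eq r
  exact ⟨t, h1, h2⟩

theorem RatCode.val_lt_iff (s t : RatCode) : s.val < t.val ↔
    s.1 * (t.2.2 + 1) + t.2.1 * (s.2.2 + 1) < t.1 * (s.2.2 + 1) + s.2.1 * (t.2.2 + 1) := by
  rw [RatCode.val, RatCode.val, div_lt_div_iff₀ (by positivity) (by positivity),
    ← Nat.cast_lt (α := ℚ)]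
  push_cast
  constructor <;> intro h <;> linarith

@[fun_prop]
theorem Comp.ratCode_add {f g : α → RatCode} (hf : Comp f) (hg : Comp g) :
    Comp fun a => (f a).add (g a) := by
  unfold RatCode.add
  fun_prop

@[fun_prop]
theorem Comp.ratCode_twoPow {f g : α → ℕ} (hf : Comp f) (hg : Comp g) :
    Comp fun a => RatCode.twoPow (f a) (g a) := by
  unfold RatCode.twoPow
  fun_prop

theorem REPred.val_lt {f g : α → RatCode} (hf : Comp f) (hg : Comp g) :
    REPred fun a => (f a).val < (g a).val := by
  simp only [RatCode.val_lt_iff]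
  exact REPred.lt (by fun_prop) (by fun_prop)

/-! ### Names of rational numbers -/

/-- In `natNot` the word is first coerced to a list of numbers. A fold over the symbols themselves
is easier to show primitive recursive. -/
theorem natNot_iff {w : Word k} {n : ℕ} : natNot w n ↔ (∀ a ∈ w, a = 0 ∨ a = 1) ∧
    n = w.foldl (fun m (a : Sym k) => 2 * m + a.val) 0 := by
  have h : (do let a ← w; pure (a : ℕ) : List ℕ) = w.map Fin.val := by
    induction w with
    | nil => rfl
    | cons a w ih => simp [← ih]
  rw [natNot, h, List.foldl_map]

theorem exists_natNot (n : ℕ) : ∃ w : Word k, natNot w n := by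
  induction n using Nat.strong_induction_on with
  | _ n ih =>
    rcases Nat.eq_zero_or_pos n with rfl | hn
    · exact ⟨[], by simp [natNot_iff]⟩
    · obtain ⟨w, hw⟩ := ih (n / 2) (Nat.div_lt_self hn one_lt_two)
      obtain ⟨hw, hv⟩ := natNot_iff.1 hw
      rcases Nat.mod_two_eq_zero_or_one n with h | h
      · refine ⟨w ++ [0], natNot_iff.2 ⟨fun a ha => ?_, ?_⟩⟩
        · rcases List.mem_append.1 ha with h | h
          · exact hw a h
          · exact Or.inl (by simpa using h)
        · rw [List.foldl_append, ← hv]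
          simp
          omega
      · refine ⟨w ++ [1], natNot_iff.2 ⟨fun a ha => ?_, ?_⟩⟩
        · rcases List.mem_append.1 ha with h | h
          · exact hw a h
          · exact Or.inr (by simpa using h)
        · rw [List.foldl_append, ← hv]
          simp
          omega

theorem REPred.natNot : REPred fun x : Word k × ℕ => natNot x.1 x.2 := by
  have h1 : PrimrecPred fun x : Word k × ℕ => ∀ a ∈ x.1, a = 0 ∨ a = 1 := by
    have h : PrimrecPred fun a : Sym k => a = 0 ∨ a = 1 :=
      (Primrec.eq.comp Primrec.id (Primrec.const 0)).or
        (Primrec.eq.comp Primrec.id (Primrec.const 1))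
    exact h.forall_mem_list.comp Primrec.fst
  have h2 : Primrec fun x : Word k × ℕ => x.1.foldl (fun m (a : Sym k) => 2 * m + a.val) 0 := by
    refine Primrec.list_foldl (h := fun (_ : Word k × ℕ) (y : ℕ × Sym k) => 2 * y.1 + y.2.val)
      Primrec.fst (Primrec.const 0) ?_
    exact Primrec.nat_add.comp (Primrec.nat_mul.comp (Primrec.const 2)
      (Primrec.fst.comp Primrec.snd)) (Primrec.fin_val.comp (Primrec.snd.comp Primrec.snd))
  exact (h1.computablePred.to_re.and (Primrec.eq.comp Primrec.snd h2).computablePred.to_re).of_eq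
    fun x => natNot_iff.symm

/-- `u` is a name of the rational number coded by `t`, with the same numerators and
denominator. -/
def RatName (x : Word k × RatCode) : Prop :=
  ∃ y : Word k × Word k × Word k, x.1 = tuple [y.1, y.2.1, y.2.2] ∧ natNot y.1 x.2.1 ∧
    natNot y.2.1 x.2.2.1 ∧ natNot y.2.2 (x.2.2.2 + 1)

theorem REPred.ratName : REPred (RatName : Word k × RatCode → Prop) := by
  refine REPred.exists (p := fun (x : Word k × RatCode) (y : Word k × Word k × Word k) =>
    x.1 = tuple [y.1, y.2.1, y.2.2] ∧ TTE.natNot y.1 x.2.1 ∧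
    TTE.natNot y.2.1 x.2.2.1 ∧ TTE.natNot y.2.2 (x.2.2.2 + 1)) ?_
  refine REPred.and (REPred.eq (by fun_prop) (by fun_prop)) (REPred.and ?_ (REPred.and ?_ ?_))
  · exact REPred.natNot.comp' (f := fun z : (Word k × RatCode) × Word k × Word k × Word k =>
      (z.2.1, z.1.2.1)) (by fun_prop)
  · exact REPred.natNot.comp' (f := fun z : (Word k × RatCode) × Word k × Word k × Word k =>
      (z.2.2.1, z.1.2.2.1)) (by fun_prop)
  · exact REPred.natNot.comp' (f := fun z : (Word k × RatCode) × Word k × Word k × Word k =>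
      (z.2.2.2, z.1.2.2.2 + 1)) (by fun_prop)

theorem exists_ratName (t : RatCode) : ∃ u : Word k, RatName (u, t) := by
  obtain ⟨x, hx⟩ := exists_natNot (k := k) t.1
  obtain ⟨y, hy⟩ := exists_natNot (k := k) t.2.1
  obtain ⟨z, hz⟩ := exists_natNot (k := k) (t.2.2 + 1)
  exact ⟨_, (x, y, z), rfl, hx, hy, hz⟩

theorem RatName.ratNot {u : Word k} {t : RatCode} (h : RatName (u, t)) : ratNot u t.val := by
  obtain ⟨⟨x, y, z⟩, h0, h1, h2, h3⟩ := h
  exact ⟨x, y, z, _, _, _, h0, h1, h2, h3, Nat.succ_ne_zero _, by simp [RatCode.val]⟩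

theorem exists_ratName_of_ratNot {u : Word k} {r : ℚ} (h : ratNot u r) :
    ∃ t : RatCode, RatName (u, t) ∧ t.val = r := by
  obtain ⟨x, y, z, a, b, c, h0, h1, h2, h3, hc, hr⟩ := h
  obtain ⟨c, rfl⟩ := Nat.exists_eq_succ_of_ne_zero hc
  exact ⟨(a, b, c), ⟨(x, y, z), h0, h1, h2, h3⟩, by simp [RatCode.val, hr]⟩

theorem ratNot_unique {u : Word k} {r r' : ℚ} (h : ratNot u r) (h' : ratNot u r') : r = r' := by
  obtain ⟨x, y, z, a, b, c, h0, h1, h2, h3, hc, hr⟩ := h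
  obtain ⟨x', y', z', a', b', c', h0', h1', h2', h3', hc', hr'⟩ := h'
  have := tuple_injective (h0.symm.trans h0')
  simp only [List.cons.injEq, and_true] at this
  obtain ⟨rfl, rfl, rfl⟩ := this
  rw [hr, hr', h1.2, h1'.2, h2.2, h2'.2, h3.2, h3'.2]

theorem RatName.exists_iff {u : Word k} {t : RatCode} (h : RatName (u, t)) (P : ℚ → Prop) :
    (∃ r, TTE.ratNot u r ∧ P r) ↔ P t.val :=
  ⟨fun ⟨_, hr, hP⟩ => ratNot_unique h.ratNot hr ▸ hP, fun hP => ⟨_, h.ratNot, hP⟩⟩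

/-! ### Machines on finite words -/

theorem Machine.comp_run (M : Machine k) :
    Comp fun x : Word k × ℕ => M.run (wordTape x.1) x.2 := by
  let h : Word k × ℕ → ℕ × ℕ × Word k → ℕ × Word k := fun x y =>
    ((M.step y.2.1 (x.1[y.1]?)).1, y.2.2 ++ (M.step y.2.1 (x.1[y.1]?)).2)
  have hM : Comp fun x : ℕ × Option (Sym k) => M.step x.1 x.2 := M.computable_step
  have h0 : Comp fun z : (Word k × ℕ) × ℕ × ℕ × Word k => (z.2.2.1, z.1.1[z.2.1]?) := by fun_prop
  have h1 := hM.comp h0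
  have h2 : Comp fun z : (Word k × ℕ) × ℕ × ℕ × Word k => h z.1 z.2 := by
    simp only [h]
    fun_prop
  have h3 : Computable₂ h := h2
  have h4 : Computable fun _ : Word k × ℕ => (M.init, ([] : Word k)) := Computable.const _
  have h5 := Computable.nat_rec (Computable.snd (α := Word k)) h4 h3
  refine h5.of_eq fun x => ?_
  induction x.2 with
  | zero => rfl
  | succ n ih => simp only [ih]; rfl

/-- Simulate the machine and search its output; `b = 0` and `b = 1` select the two tracks of a
`ρ`-name. -/
theorem Machine.re_lists (M : Machine k) (b : ℕ) : REPred fun x : Word k × Word k =>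
    ∃ y : ℕ × ℕ, ∀ j < (wrap x.2).length,
      (M.run (wordTape x.1) y.1).2[2 * (y.2 + j) + b]? = (wrap x.2)[j]? := by
  refine REPred.exists (p := fun (x : Word k × Word k) (y : ℕ × ℕ) => ∀ j < (wrap x.2).length,
      (M.run (wordTape x.1) y.1).2[2 * (y.2 + j) + b]? = (wrap x.2)[j]?) ?_
  refine REPred.forall_lt (p := fun (z : (Word k × Word k) × ℕ × ℕ) j =>
      (M.run (wordTape z.1.1) z.2.1).2[2 * (z.2.2 + j) + b]? = (wrap z.1.2)[j]?) ?_ (by fun_prop)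
  have h0 : Comp fun z : ((Word k × Word k) × ℕ × ℕ) × ℕ => (z.1.1.1, z.1.2.1) := by fun_prop
  have h1 := M.comp_run.comp h0
  exact REPred.eq (by fun_prop) (by fun_prop)

theorem Machine.Writes.lists_iff {M : Machine k} {t : ℕ → Option (Sym k)} {q : Seq k}
    (h : M.Writes t q) (b : ℕ) (x : Word k) :
    Lists (fun n => q (2 * n + b)) x ↔ ∃ y : ℕ × ℕ, ∀ j < (wrap x).length,
      (M.run t y.1).2[2 * (y.2 + j) + b]? = (wrap x)[j]? := by
  rw [lists_iff_exists_getElem?]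
  constructor
  · rintro ⟨i, hi⟩
    obtain ⟨n, hn⟩ := h.2 (2 * (i + (wrap x).length) + b)
    refine ⟨(n, i), fun j hj => ?_⟩
    rw [hi j hj, h.1 n]
    simp only [Seq.take]
    rw [List.getElem?_map, List.getElem?_range (by omega)]
    rfl
  · rintro ⟨⟨n, i⟩, hy⟩
    refine ⟨i, fun j hj => ?_⟩
    have h1 := hy j hj
    -- The position has been written, since its optional content equals an existing entry of the
    -- code.
    have h2 : 2 * (i + j) + b < (M.run t n).2.length := by
      by_contra hcon
      rw [List.getElem?_eq_none (not_lt.1 hcon)] at h1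
      simp [hj] at h1
    rw [← h1, h.1 n]
    simp only [Seq.take]
    rw [List.getElem?_map, List.getElem?_range h2]
    rfl

theorem Machine.Writes.unique {M : Machine k} {t : ℕ → Option (Sym k)} {q q' : Seq k}
    (h : M.Writes t q) (h' : M.Writes t q') : q = q' := by
  funext i
  obtain ⟨n, hn⟩ := h.2 (i + 1)
  have h1 := (h.1 n).symm.trans (h'.1 n)
  have h2 := congrArg (fun l => l[i]?) h1
  simpa [Seq.take, Nat.lt_of_succ_le hn] using h2

/-! ### Confirming properties of names of ring elements -/

variable {Ω : Type*} [MeasurableSpace Ω]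

/-- Search the lower track of the output for some name of the rational number. Since a `ρ_<`-name
lists all names of the numbers below, any one name will do. -/
theorem IsComputableMeasure.exists_re_lower {S : ComputableSigmaAlgebra k Ω} {μ : Measure Ω}
    (hμ : IsComputableMeasure S μ) : ∃ P : Word k × RatCode → Prop, REPred P ∧
      ∀ w, ∀ R ∈ S.nota w, ∀ t : RatCode, P (w, t) ↔ (t.val : ℝ) < μ.real R := by
  obtain ⟨-, M, hM⟩ := hμ
  refine ⟨fun x => ∃ u, RatName (u, x.2) ∧ ∃ y : ℕ × ℕ, ∀ j < (wrap u).length,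
      (M.run (wordTape x.1) y.1).2[2 * (y.2 + j) + 0]? = (wrap u)[j]?,
    REPred.exists (p := fun (x : Word k × RatCode) u => RatName (u, x.2) ∧ ∃ y : ℕ × ℕ,
      ∀ j < (wrap u).length, (M.run (wordTape x.1) y.1).2[2 * (y.2 + j) + 0]? = (wrap u)[j]?)
      (REPred.and ?_ ?_), fun w R hR t => ?_⟩
  · exact REPred.ratName.comp' (f := fun z : (Word k × RatCode) × Word k => (z.2, z.1.2))
      (by fun_prop)
  · exact (M.re_lists 0).comp' (f := fun z : (Word k × RatCode) × Word k => (z.1.1, z.2))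
      (by fun_prop)
  · obtain ⟨q, hq, hl, -⟩ := hM w R hR
    have key : ∀ u, RatName (u, t) → ((∃ y : ℕ × ℕ, ∀ j < (wrap u).length,
      (M.run (wordTape w) y.1).2[2 * (y.2 + j) + 0]? = (wrap u)[j]?) ↔ (t.val : ℝ) < μ.real R) :=
      fun u hu => by rw [← hq.lists_iff]; exact (hl u).trans (hu.exists_iff fun r => (r : ℝ) < _)
    constructor
    · rintro ⟨u, hu, h⟩
      exact (key u hu).1 h
    · intro h
      obtain ⟨u, hu⟩ := exists_ratName (k := k) t
      exact ⟨u, hu, (key u hu).2 h⟩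

theorem IsComputableMeasure.exists_re_upper {S : ComputableSigmaAlgebra k Ω} {μ : Measure Ω}
    (hμ : IsComputableMeasure S μ) : ∃ P : Word k × RatCode → Prop, REPred P ∧
      ∀ w, ∀ R ∈ S.nota w, ∀ t : RatCode, P (w, t) ↔ μ.real R < (t.val : ℝ) := by
  obtain ⟨-, M, hM⟩ := hμ
  refine ⟨fun x => ∃ u, RatName (u, x.2) ∧ ∃ y : ℕ × ℕ, ∀ j < (wrap u).length,
      (M.run (wordTape x.1) y.1).2[2 * (y.2 + j) + 1]? = (wrap u)[j]?,
    REPred.exists (p := fun (x : Word k × RatCode) u => RatName (u, x.2) ∧ ∃ y : ℕ × ℕ,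
      ∀ j < (wrap u).length, (M.run (wordTape x.1) y.1).2[2 * (y.2 + j) + 1]? = (wrap u)[j]?)
      (REPred.and ?_ ?_), fun w R hR t => ?_⟩
  · exact REPred.ratName.comp' (f := fun z : (Word k × RatCode) × Word k => (z.2, z.1.2))
      (by fun_prop)
  · exact (M.re_lists 1).comp' (f := fun z : (Word k × RatCode) × Word k => (z.1.1, z.2))
      (by fun_prop)
  · obtain ⟨q, hq, -, hl⟩ := hM w R hR
    have key : ∀ u, RatName (u, t) → ((∃ y : ℕ × ℕ, ∀ j < (wrap u).length,
      (M.run (wordTape w) y.1).2[2 * (y.2 + j) + 1]? = (wrap u)[j]?) ↔ μ.real R < (t.val : ℝ)) :=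
      fun u hu => by rw [← hq.lists_iff]; exact (hl u).trans (hu.exists_iff fun r => _ < (r : ℝ))
    constructor
    · rintro ⟨u, hu, h⟩
      exact (key u hu).1 h
    · intro h
      obtain ⟨u, hu⟩ := exists_ratName (k := k) t
      exact ⟨u, hu, (key u hu).2 h⟩

theorem ComputableSigmaAlgebra.exists_re_sdiff (S : ComputableSigmaAlgebra k Ω) :
    ∃ P : (Word k × Word k) × Word k → Prop, REPred P ∧
      ∀ u v A B, A ∈ S.nota u → B ∈ S.nota v →
        (∃ w, P ((u, v), w)) ∧ ∀ w, P ((u, v), w) → A \ B ∈ S.nota w := by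
  obtain ⟨f, hf, h⟩ := S.computable_sdiff
  refine ⟨_, hf.graph_re, fun u v A B hA hB => ?_⟩
  obtain ⟨w, hw, hw'⟩ := h u v A B hA hB
  exact ⟨⟨w, hw⟩, fun w' hw'' => by
    obtain rfl : w = w' := Part.mem_unique hw hw''
    exact hw'⟩

/-- Uses `A ∩ B = A \ (A \ B)`. -/
theorem ComputableSigmaAlgebra.exists_re_inter (S : ComputableSigmaAlgebra k Ω) :
    ∃ P : (Word k × Word k) × Word k → Prop, REPred P ∧
      ∀ u v A B, A ∈ S.nota u → B ∈ S.nota v →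
        (∃ w, P ((u, v), w)) ∧ ∀ w, P ((u, v), w) → A ∩ B ∈ S.nota w := by
  obtain ⟨P, hP, h⟩ := S.exists_re_sdiff
  refine ⟨fun x => ∃ w, P (x.1, w) ∧ P ((x.1.1, w), x.2),
    REPred.exists (p := fun (x : (Word k × Word k) × Word k) w => P (x.1, w) ∧
      P ((x.1.1, w), x.2)) (REPred.and ?_ ?_), fun u v A B hA hB => ?_⟩
  · exact hP.comp' (f := fun z : ((Word k × Word k) × Word k) × Word k => (z.1.1, z.2))
      (by fun_prop)
  · exact hP.comp' (f := fun z : ((Word k × Word k) × Word k) × Word k =>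
      ((z.1.1.1, z.2), z.1.2)) (by fun_prop)
  · obtain ⟨⟨w, hw⟩, h1⟩ := h u v A B hA hB
    obtain ⟨⟨w', hw'⟩, -⟩ := h u w A (A \ B) hA (h1 w hw)
    refine ⟨⟨w', w, hw, hw'⟩, ?_⟩
    rintro z ⟨y, hy, hz⟩
    rw [← Set.sdiff_sdiff_right_self]
    exact (h u y A (A \ B) hA (h1 y hy)).2 z hz

end

section

variable {k : ℕ} {Ω : Type*} [MeasurableSpace Ω]

/-! ### Classes of measurable sets -/

/-- The class of a measurable set. -/
def cls (μ : Measure Ω) (A : {A : Set Ω // MeasurableSet A}) : Classes μ :=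
  Quotient.mk (essSetoid μ) A

theorem exists_cls_eq {μ : Measure Ω} (x : Classes μ) : ∃ A, cls μ A = x := Quotient.exists_rep x

@[simp]
theorem interMeasure_cls (μ : Measure Ω) (R : Set Ω) (A : {A : Set Ω // MeasurableSet A}) :
    interMeasure μ R (cls μ A) = μ.real (R ∩ A.1) := rfl

/-- The restrictions of `μ` to `A` and `B` agree, with finite values, on a countable generating
π-system that covers `Ω`, hence everywhere. Evaluating them at `A \ B` and `B \ A` gives null sets.
-/
theorem eq_of_interMeasure_eq (S : ComputableSigmaAlgebra k Ω) {μ : Measure Ω}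
    (hμ : ∀ R ∈ S.ring, μ R < ∞) {x y : Classes μ}
    (h : ∀ R ∈ S.ring, interMeasure μ R x = interMeasure μ R y) : x = y := by
  obtain ⟨⟨A, hA⟩, rfl⟩ := exists_cls_eq x
  obtain ⟨⟨B, hB⟩, rfl⟩ := exists_cls_eq y
  simp only [interMeasure_cls] at h
  have hfin : ∀ R ∈ S.ring, ∀ C, μ (R ∩ C) ≠ ∞ := fun R hR C =>
    ((measure_mono Set.inter_subset_left).trans_lt (hμ R hR)).ne
  have key : μ.restrict A = μ.restrict B := by
    refine Measure.ext_of_generateFrom_of_cover_subset S.generateFrom_ring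
      S.isSetRing.isSetSemiring.isPiSystem subset_rfl S.countable_ring S.sUnion_ring
      (fun R hR => ?_) fun R hR => ?_
    · rw [Measure.restrict_apply (S.measurableSet_of_mem_ring hR)]
      exact hfin R hR A
    · rw [Measure.restrict_apply (S.measurableSet_of_mem_ring hR),
        Measure.restrict_apply (S.measurableSet_of_mem_ring hR)]
      exact (measureReal_eq_measureReal_iff (hfin R hR A) (hfin R hR B)).1 (h R hR)
  refine Quotient.sound (show μ (A ∆ B) = 0 from ?_)
  have h1 : μ (A \ B) = 0 := by
    have := congrArg (fun ν => ν (A \ B)) key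
    simp only [Measure.restrict_apply (hA.diff hB)] at this
    rw [Set.inter_eq_left.2 Set.sdiff_subset] at this
    rw [this]
    simp
  have h2 : μ (B \ A) = 0 := by
    have := congrArg (fun ν => ν (B \ A)) key
    simp only [Measure.restrict_apply (hB.diff hA)] at this
    rw [Set.inter_eq_left.2 (Set.sdiff_subset (s := B))] at this
    rw [← this]
    simp
  exact measure_union_null h1 h2

/-- Restricted to the union of the first `N` sets, `μ` is finite, so the generating ring
approximates `A`. The error on each `F i` is at most the error on the union. -/
theorem ComputableSigmaAlgebra.exists_mem_ring_measure_lt (S : ComputableSigmaAlgebra k Ω)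
    {μ : Measure Ω} (hμ : ∀ R ∈ S.ring, μ R < ∞) {F : ℕ → Set Ω} (hF : ∀ i, F i ∈ S.ring)
    {A : Set Ω} (hA : MeasurableSet A) (N : ℕ) {ε : ℝ} (hε : 0 < ε) :
    ∃ R ∈ S.ring, ∀ i < N, μ.real (F i ∩ (R ∆ A)) < ε := by
  let E := ⋃ i ∈ Finset.range N, F i
  have hE : E ∈ S.ring := S.isSetRing.biUnion_mem _ fun i _ => hF i
  have : IsFiniteMeasure (μ.restrict E) := ⟨by simpa using hμ E hE⟩
  obtain ⟨R, hR, hlt⟩ := exists_measure_symmDiff_lt_of_generateFrom_isSetRing (μ := μ.restrict E)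
    S.isSetRing ⟨S.ring, S.countable_ring, subset_rfl, by simp [S.sUnion_ring]⟩
    S.generateFrom_ring hA (ENNReal.ofReal_pos.2 hε)
  refine ⟨R, hR, fun i hi => ?_⟩
  rw [Measure.restrict_apply ((S.measurableSet_of_mem_ring hR).symmDiff hA)] at hlt
  refine (ENNReal.lt_ofReal_iff_toReal_lt ?_).1 (lt_of_le_of_lt (measure_mono ?_) hlt)
  · exact ((measure_mono Set.inter_subset_left).trans_lt (hμ _ (hF i))).ne
  · rintro a ⟨ha, ha'⟩
    exact ⟨ha', Set.mem_biUnion (Finset.mem_coe.2 (Finset.mem_range.2 hi)) ha⟩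

/-! ### The distance -/

theorem div_one_add_le_div_one_add {s t : ℝ} (hs : 0 ≤ s) (h : s ≤ t) :
    s / (1 + s) ≤ t / (1 + t) := by
  rw [div_le_div_iff₀ (by linarith) (by linarith)]
  linarith

/-- Split the numerator and shrink each denominator. With monotonicity, this gives the triangle
inequality for `dbar` term by term. -/
theorem add_div_one_add_le {s t : ℝ} (hs : 0 ≤ s) (ht : 0 ≤ t) :
    (s + t) / (1 + (s + t)) ≤ s / (1 + s) + t / (1 + t) := by
  rw [add_div]
  gcongr <;> linarith

section dbar

variable {μ : Measure Ω} {F : ℕ → Set Ω}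

theorem summable_dbar (m : ℕ → ℝ) (hm : ∀ i, 0 ≤ m i) :
    Summable fun i => m i / (1 + m i) * (2 : ℝ)⁻¹ ^ i := by
  refine Summable.of_nonneg_of_le (fun i => ?_) (fun i => ?_)
    (summable_geometric_of_lt_one (by norm_num : (0 : ℝ) ≤ 2⁻¹) (by norm_num))
  · have := hm i
    positivity
  · refine mul_le_of_le_one_left (by positivity) ?_
    rw [div_le_one (by linarith [hm i])]
    linarith

theorem dbar_cls (A B : {A : Set Ω // MeasurableSet A}) : dbar μ F (cls μ A) (cls μ B) =
    ∑' i, μ.real (F i ∩ (A.1 ∆ B.1)) / (1 + μ.real (F i ∩ (A.1 ∆ B.1))) * (2 : ℝ)⁻¹ ^ i := rfl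

theorem dbar_comm (x y : Classes μ) : dbar μ F x y = dbar μ F y x := by
  obtain ⟨A, rfl⟩ := exists_cls_eq x
  obtain ⟨B, rfl⟩ := exists_cls_eq y
  simp only [dbar_cls, symmDiff_comm]

theorem dbar_nonneg (x y : Classes μ) : 0 ≤ dbar μ F x y := by
  obtain ⟨A, rfl⟩ := exists_cls_eq x
  obtain ⟨B, rfl⟩ := exists_cls_eq y
  exact tsum_nonneg fun i => by positivity

theorem dbar_triangle (hF : ∀ i, μ (F i) < ∞) (x y z : Classes μ) :
    dbar μ F x z ≤ dbar μ F x y + dbar μ F y z := by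
  obtain ⟨A, rfl⟩ := exists_cls_eq x
  obtain ⟨B, rfl⟩ := exists_cls_eq y
  obtain ⟨C, rfl⟩ := exists_cls_eq z
  simp only [dbar_cls]
  rw [← (summable_dbar _ fun _ => measureReal_nonneg).tsum_add
    (summable_dbar _ fun _ => measureReal_nonneg)]
  refine (summable_dbar _ fun _ => measureReal_nonneg).tsum_le_tsum (fun i => ?_)
    ((summable_dbar _ fun _ => measureReal_nonneg).add
      (summable_dbar _ fun _ => measureReal_nonneg))
  rw [← add_mul]
  gcongr
  refine le_trans (div_one_add_le_div_one_add measureReal_nonneg ?_)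
    (add_div_one_add_le measureReal_nonneg measureReal_nonneg)
  refine le_trans (measureReal_mono ?_ ?_) (measureReal_union_le _ _)
  · rw [← Set.inter_union_distrib_left]
    exact Set.inter_subset_inter_right _ (symmDiff_triangle _ _ _)
  · rw [← Set.inter_union_distrib_left]
    exact ((measure_mono Set.inter_subset_left).trans_lt (hF i)).ne

/-- A single term of the series gives `m / (1 + m) ≤ 2^i / 2^j`. The right side is at most `1/2` as
`i < j`, so solving for `m` costs only a factor `2`. -/
theorem measureReal_le_of_dbar_le {A B : {A : Set Ω // MeasurableSet A}} {i j : ℕ} (hij : i < j)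
    (h : dbar μ F (cls μ A) (cls μ B) ≤ (2 : ℝ)⁻¹ ^ j) :
    μ.real (F i ∩ (A.1 ∆ B.1)) ≤ 2 * 2 ^ i / 2 ^ j := by
  rw [dbar_cls] at h
  have h1 := ((summable_dbar (fun i => μ.real (F i ∩ (A.1 ∆ B.1)))
    fun _ => measureReal_nonneg).le_tsum i fun i _ => by positivity).trans h
  have h0 : 0 ≤ μ.real (F i ∩ (A.1 ∆ B.1)) := measureReal_nonneg
  generalize μ.real (F i ∩ (A.1 ∆ B.1)) = m at h0 h1
  obtain ⟨d, rfl⟩ := Nat.exists_eq_add_of_lt hij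
  have e : (2 : ℝ)⁻¹ ^ (i + d + 1) = (2⁻¹ ^ d / 2) * 2⁻¹ ^ i := by ring
  have e' : (2 : ℝ) * 2 ^ i / 2 ^ (i + d + 1) = 2⁻¹ ^ d := by
    rw [inv_pow]; field_simp; ring
  rw [e'] at *
  rw [e] at h1
  have h2 := le_of_mul_le_mul_right h1 (by positivity)
  rw [div_le_iff₀ (by linarith)] at h2
  have h3 : (2 : ℝ)⁻¹ ^ d ≤ 1 := pow_le_one₀ (by norm_num) (by norm_num)
  have h4 : (2 : ℝ)⁻¹ ^ d * m ≤ 1 * m := by gcongr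
  linarith

/-- Only `F₀, …, Fₙ` meet `R`, so the error is at most the sum of `2 * 2^i / 2^j` over `i ≤ n`, a
geometric sum. -/
theorem interMeasure_le_add (hF : ∀ i, μ (F i) < ∞) {R : Set Ω} {n j : ℕ}
    (hR : R ⊆ ⋃ i ≤ n, F i) (hnj : n < j) {x y : Classes μ}
    (h : dbar μ F x y ≤ (2 : ℝ)⁻¹ ^ j) :
    interMeasure μ R x ≤ interMeasure μ R y + 2 ^ (n + 2) / 2 ^ j := by
  obtain ⟨A, rfl⟩ := exists_cls_eq x
  obtain ⟨B, rfl⟩ := exists_cls_eq y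
  simp only [interMeasure_cls]
  have hfin : ∀ i C, μ (F i ∩ C) < ∞ := fun i C =>
    (measure_mono Set.inter_subset_left).trans_lt (hF i)
  have hRfin : μ R < ∞ := by
    refine (measure_mono hR).trans_lt ?_
    exact measure_biUnion_lt_top (Set.finite_le_nat n) fun i _ => hF i
  have hsub : R ∩ A.1 ⊆ (R ∩ B.1) ∪ ⋃ i ∈ Finset.range (n + 1), F i ∩ (A.1 ∆ B.1) := by
    rintro a ⟨haR, haA⟩
    by_cases haB : a ∈ B.1
    · exact Or.inl ⟨haR, haB⟩
    · right
      obtain ⟨i, hi⟩ := Set.mem_iUnion.1 (hR haR)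
      obtain ⟨hin, hai⟩ := Set.mem_iUnion.1 hi
      refine Set.mem_iUnion₂.2 ⟨i, Finset.mem_range.2 (Nat.lt_succ_of_le hin), hai, Or.inl
        ⟨haA, haB⟩⟩
  have hfinU : μ (⋃ i ∈ Finset.range (n + 1), F i ∩ (A.1 ∆ B.1)) < ∞ :=
    measure_biUnion_lt_top (Finset.finite_toSet _) fun i _ => hfin i _
  have h1 : μ.real (R ∩ A.1) ≤
      μ.real (R ∩ B.1) + ∑ i ∈ Finset.range (n + 1), μ.real (F i ∩ (A.1 ∆ B.1)) := by
    refine (measureReal_mono hsub ?_).trans ((measureReal_union_le _ _).trans ?_)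
    · exact (measure_union_lt_top ((measure_mono Set.inter_subset_left).trans_lt hRfin) hfinU).ne
    · gcongr
      exact measureReal_biUnion_finset_le _ _
  have h2 : ∑ i ∈ Finset.range (n + 1), μ.real (F i ∩ (A.1 ∆ B.1)) ≤
      ∑ i ∈ Finset.range (n + 1), (2 : ℝ) ^ i * (2 / 2 ^ j) := by
    refine Finset.sum_le_sum fun i hi => ?_
    refine (measureReal_le_of_dbar_le ?_ h).trans_eq (by ring)
    have := Finset.mem_range.1 hi
    omega
  rw [← Finset.sum_mul, geom_sum_eq (by norm_num)] at h2
  have h3 : ((2 : ℝ) ^ (n + 1) - 1) / (2 - 1) * (2 / 2 ^ j) ≤ 2 ^ (n + 2) / 2 ^ j := by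
    have : (2 : ℝ) ^ (n + 2) / 2 ^ j - ((2 : ℝ) ^ (n + 1) - 1) / (2 - 1) * (2 / 2 ^ j) =
      2 / 2 ^ j := by ring
    have h4 : (0 : ℝ) < 2 / 2 ^ j := by positivity
    linarith
  linarith

/-- Applied with `A` in the ring and `B` the unknown set: then `F i ∩ A` and `F i \ A` lie in the
ring, so every term besides the symmetric difference can be bounded effectively. -/
theorem measureReal_inter_symmDiff (hF : ∀ i, μ (F i) < ∞) (hFm : ∀ i, MeasurableSet (F i))
    (A B : {A : Set Ω // MeasurableSet A}) (i : ℕ) :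
    μ.real (F i ∩ (A.1 ∆ B.1)) + interMeasure μ (F i ∩ A.1) (cls μ B) =
      μ.real (F i ∩ A.1) + interMeasure μ (F i \ A.1) (cls μ B) := by
  simp only [interMeasure_cls]
  have hfin : ∀ C, μ (F i ∩ C) ≠ ∞ := fun C =>
    ((measure_mono Set.inter_subset_left).trans_lt (hF i)).ne
  have e : F i ∩ (A.1 ∆ B.1) = ((F i ∩ A.1) \ B.1) ∪ ((F i \ A.1) ∩ B.1) := by
    ext a
    simp only [Set.mem_inter_iff, Set.mem_symmDiff, Set.mem_union, Set.mem_sdiff]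
    tauto
  have hd : Disjoint ((F i ∩ A.1) \ B.1) ((F i \ A.1) ∩ B.1) :=
    Set.disjoint_left.2 fun a h h' => h.2 h'.2
  have h1 : μ ((F i ∩ A.1) \ B.1) ≠ ∞ :=
    ((measure_mono Set.sdiff_subset).trans_lt (hfin A.1).lt_top).ne
  have h2 : μ ((F i \ A.1) ∩ B.1) ≠ ∞ :=
    ((measure_mono (Set.inter_subset_left.trans Set.sdiff_subset)).trans_lt (hF i)).ne
  rw [e, measureReal_union hd (((hFm i).diff A.2).inter B.2) h1 h2,
    ← measureReal_inter_add_sdiff (s := F i ∩ A.1) B.2 (hfin _)]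
  ring

/-- The first `n + 3` terms and the tail contribute at most `2 * 2^-(n+3)` each. -/
theorem dbar_le_of_forall_lt {A B : {A : Set Ω // MeasurableSet A}} {n : ℕ}
    (h : ∀ i < n + 3, μ.real (F i ∩ (A.1 ∆ B.1)) < 1 / 2 ^ (n + 3)) :
    dbar μ F (cls μ A) (cls μ B) ≤ (2 : ℝ)⁻¹ ^ (n + 1) := by
  have hg : Summable fun i : ℕ => (2 : ℝ)⁻¹ ^ i :=
    summable_geometric_of_lt_one (by norm_num : (0 : ℝ) ≤ 2⁻¹) (by norm_num)
  have hg' : ∑' i : ℕ, (2 : ℝ)⁻¹ ^ i = 2 := by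
    rw [tsum_geometric_of_lt_one (by norm_num) (by norm_num)]; norm_num
  have hs := summable_dbar (fun i => μ.real (F i ∩ (A.1 ∆ B.1))) fun _ => measureReal_nonneg
  rw [dbar_cls, ← hs.sum_add_tsum_nat_add (n + 3)]
  have h1 : ∑ i ∈ Finset.range (n + 3),
      μ.real (F i ∩ (A.1 ∆ B.1)) / (1 + μ.real (F i ∩ (A.1 ∆ B.1))) * (2 : ℝ)⁻¹ ^ i ≤
      ∑ i ∈ Finset.range (n + 3), (2 : ℝ)⁻¹ ^ i * (1 / 2 ^ (n + 3)) := by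
    refine Finset.sum_le_sum fun i hi => ?_
    rw [mul_comm]
    refine mul_le_mul_of_nonneg_left ?_ (by positivity)
    refine (div_le_self measureReal_nonneg ?_).trans (h i (Finset.mem_range.1 hi)).le
    have : 0 ≤ μ.real (F i ∩ (A.1 ∆ B.1)) := measureReal_nonneg
    linarith
  have h2 : ∑ i ∈ Finset.range (n + 3), (2 : ℝ)⁻¹ ^ i ≤ 2 :=
    (hg.sum_le_tsum _ fun i _ => by positivity).trans_eq hg'
  have h3 : ∑' i, μ.real (F (i + (n + 3)) ∩ (A.1 ∆ B.1)) /
      (1 + μ.real (F (i + (n + 3)) ∩ (A.1 ∆ B.1))) * (2 : ℝ)⁻¹ ^ (i + (n + 3)) ≤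
      ∑' i : ℕ, (2 : ℝ)⁻¹ ^ i * 2⁻¹ ^ (n + 3) := by
    refine ((summable_nat_add_iff (n + 3)).2 hs).tsum_le_tsum (fun i => ?_) (hg.mul_right _)
    rw [← pow_add]
    refine mul_le_of_le_one_left (by positivity) ?_
    have : 0 ≤ μ.real (F (i + (n + 3)) ∩ (A.1 ∆ B.1)) := measureReal_nonneg
    rw [div_le_one (by linarith)]
    linarith
  rw [tsum_mul_right, hg'] at h3
  rw [← Finset.sum_mul] at h1
  have h4 : (∑ i ∈ Finset.range (n + 3), (2 : ℝ)⁻¹ ^ i) * (1 / 2 ^ (n + 3)) ≤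
      2 * (1 / 2 ^ (n + 3)) := by gcongr
  have h5 : (2 : ℝ)⁻¹ ^ (n + 1) = 2 * (1 / 2 ^ (n + 3)) + 2 * 2⁻¹ ^ (n + 3) := by
    rw [one_div, ← inv_pow]; ring
  linarith

end dbar

end

/-! ### Confirming measures from names of classes -/

section

variable {k : ℕ} {Ω : Type*} [MeasurableSpace Ω] {S : ComputableSigmaAlgebra k Ω} {μ : Measure Ω}
  {F : ℕ → Set Ω}

theorem ComputableSigmaAlgebra.mem_ring_of_mem_nota {w : Word k} {R : Set Ω} (h : R ∈ S.nota w) :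
    R ∈ S.ring := (S.mem_ring_iff R).2 ⟨w, h⟩

theorem ComputableSigmaAlgebra.measurableSet_of_mem_nota {w : Word k} {R : Set Ω}
    (h : R ∈ S.nota w) : MeasurableSet R :=
  S.measurableSet_of_mem_ring (S.mem_ring_of_mem_nota h)

theorem ComputableSigmaAlgebra.re_dom (S : ComputableSigmaAlgebra k Ω) :
    REPred fun w => (S.nota w).Dom := S.recursive_dom.to_re

theorem mem_beta_iff {w : Word k} {y : Classes μ} : y ∈ beta S μ w ↔
    ∃ (R : Set Ω) (h : R ∈ S.nota w), y = cls μ ⟨R, S.measurableSet_of_mem_nota h⟩ := by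
  constructor
  · rintro ⟨h, rfl⟩
    exact ⟨_, Part.get_mem (o := S.nota w) h, rfl⟩
  · rintro ⟨R, ⟨h, rfl⟩, rfl⟩
    exact ⟨h, rfl⟩

/-- Bounds of `μ(R ∩ A)` can be confirmed from `δ`-names of `[A]`, for given names of `R`. -/
def ConfirmsMeasures (S : ComputableSigmaAlgebra k Ω) (μ : Measure Ω) (δ : Rep k (Classes μ)) :
    Prop :=
  ∃ P : Seq k → Word k × RatCode × RatCode → Prop, SemiDec P ∧
    ∀ p x, δ p x → ∀ v, ∀ R ∈ S.nota v, ∀ a b : RatCode,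
      P p (v, a, b) ↔ (a.val : ℝ) < interMeasure μ R x ∧ interMeasure μ R x < (b.val : ℝ)

/-! ### The representation `ζ` -/

theorem zeta_unique (hμ : ∀ R ∈ S.ring, μ R < ∞) {p : Seq k} {x y : Classes μ}
    (hx : zeta S μ p x) (hy : zeta S μ p y) : x = y := by
  refine eq_of_interMeasure_eq S hμ fun R hR => ?_
  obtain ⟨v, hv⟩ := (S.mem_ring_iff R).1 hR
  have key : ∀ {x y : Classes μ}, zeta S μ p x → zeta S μ p y →
      interMeasure μ R x ≤ interMeasure μ R y := by
    intro x y hx hy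
    by_contra! hlt
    obtain ⟨a, ha, hax⟩ := RatCode.exists_between hlt
    -- `ζ` lists only two-sided bounds, so an arbitrary upper bound completes the triple.
    obtain ⟨b, hb, -⟩ := RatCode.exists_between (lt_add_one (interMeasure μ R x))
    obtain ⟨u, hu⟩ := exists_ratName (k := k) a
    obtain ⟨w, hw⟩ := exists_ratName (k := k) b
    obtain ⟨a', b', R', ha', hR', -, h1, -⟩ := (hy u v w).1
      ((hx u v w).2 ⟨_, _, R, hu.ratNot, hv, hw.ratNot, hax, hb⟩)
    rw [ratNot_unique ha' hu.ratNot, Part.mem_unique hR' hv] at h1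
    exact lt_asymm h1 ha
  exact le_antisymm (key hx hy) (key hy hx)

theorem exists_zeta (x : Classes μ) : ∃ p, zeta S μ p x := by
  classical
  let X : Set (Word k) := {y | ∃ u v w, y = tuple [u, v, w] ∧
    ∃ (a b : ℚ) (R : Set Ω), ratNot u a ∧ R ∈ S.nota v ∧ ratNot w b ∧
      (a : ℝ) < interMeasure μ R x ∧ interMeasure μ R x < (b : ℝ)}
  -- Enumerate all words and replace the unwanted ones by the empty word, which is not a triple.
  obtain ⟨p, hp⟩ := exists_encodesSeq fun n =>
    (((Encodable.decode n : Option (Word k)).filter fun y => decide (y ∈ X)).getD [])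
  refine ⟨p, fun u v w => ?_⟩
  rw [hp.lists_iff]
  constructor
  · rintro ⟨i, hi⟩
    cases hd : (Encodable.decode i : Option (Word k)) with
    | none => simp [hd, wrap_eq] at hi
    | some y =>
      by_cases hy : y ∈ X
      · simp only [hd, Option.filter_some, hy, decide_true, if_true, Option.getD_some] at hi
        obtain ⟨u', v', w', e, h⟩ := hy
        have := tuple_injective (e.symm.trans hi)
        simp only [List.cons.injEq, and_true] at this
        obtain ⟨rfl, rfl, rfl⟩ := this
        exact h
      · simp only [hd, Option.filter_some, hy, decide_false, Bool.false_eq_true, if_false,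
          Option.getD_none] at hi
        simp [wrap_eq] at hi
  · intro h
    refine ⟨Encodable.encode (tuple [u, v, w]), ?_⟩
    have hX : tuple [u, v, w] ∈ X := ⟨u, v, w, rfl, h⟩
    simp only [Encodable.encodek, Option.filter_some, hX, decide_true, if_true, Option.getD_some]

theorem confirmsMeasures_zeta : ConfirmsMeasures S μ (zeta S μ) := by
  refine ⟨fun p x => ∃ y : Word k × Word k, RatName (y.1, x.2.1) ∧ RatName (y.2, x.2.2) ∧
    Lists p (tuple [y.1, x.1, y.2]), SemiDec.exists_right
    (R := fun p (x : Word k × RatCode × RatCode) (y : Word k × Word k) => RatName (y.1, x.2.1) ∧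
      RatName (y.2, x.2.2) ∧ Lists p (tuple [y.1, x.1, y.2])) ?_, fun p x hx v R hR a b => ?_⟩
  · refine SemiDec.and ?_ (SemiDec.and ?_ ?_)
    · exact (SemiDec.of_re REPred.ratName).comp
        (f := fun z : (Word k × RatCode × RatCode) × Word k × Word k => (z.2.1, z.1.2.1))
        (by fun_prop)
    · exact (SemiDec.of_re REPred.ratName).comp
        (f := fun z : (Word k × RatCode × RatCode) × Word k × Word k => (z.2.2, z.1.2.2))
        (by fun_prop)
    · exact SemiDec.lists.comp
        (f := fun z : (Word k × RatCode × RatCode) × Word k × Word k =>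
          tuple [z.2.1, z.1.1, z.2.2]) (by fun_prop)
  · constructor
    · rintro ⟨⟨u, w⟩, hu, hw, hl⟩
      obtain ⟨a', b', R', ha', hR', hb', h⟩ := (hx u v w).1 hl
      rwa [ratNot_unique ha' hu.ratNot, ratNot_unique hb' hw.ratNot, Part.mem_unique hR' hR] at h
    · intro h
      obtain ⟨u, hu⟩ := exists_ratName (k := k) a
      obtain ⟨w, hw⟩ := exists_ratName (k := k) b
      exact ⟨(u, w), hu, hw, (hx u v w).2 ⟨_, _, R, hu.ratNot, hR, hw.ratNot, h⟩⟩

/-- List every confirmed triple. Membership of `v` in the domain of `α` is confirmed separately,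
because `P` is unspecified outside it. -/
theorem ConfirmsMeasures.reducible_zeta {δ : Rep k (Classes μ)} (h : ConfirmsMeasures S μ δ) :
    Reducible δ (zeta S μ) := by
  obtain ⟨P, hP, h⟩ := h
  have hR : SemiDec fun p (x : Word k) => ∃ y : (Word k × Word k × Word k) × RatCode × RatCode,
      x = tuple [y.1.1, y.1.2.1, y.1.2.2] ∧ (S.nota y.1.2.1).Dom ∧ RatName (y.1.1, y.2.1) ∧
        RatName (y.1.2.2, y.2.2) ∧ P p (y.1.2.1, y.2.1, y.2.2) := by
    refine SemiDec.exists_right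
      (R := fun p (x : Word k) (y : (Word k × Word k × Word k) × RatCode × RatCode) =>
        x = tuple [y.1.1, y.1.2.1, y.1.2.2] ∧ (S.nota y.1.2.1).Dom ∧ RatName (y.1.1, y.2.1) ∧
        RatName (y.1.2.2, y.2.2) ∧ P p (y.1.2.1, y.2.1, y.2.2)) ?_
    refine SemiDec.and (SemiDec.of_re (REPred.eq (by fun_prop) (by fun_prop)))
      (SemiDec.and ?_ (SemiDec.and ?_ (SemiDec.and ?_ ?_)))
    · exact (SemiDec.of_re S.re_dom).comp
        (f := fun z : Word k × (Word k × Word k × Word k) × RatCode × RatCode => z.2.1.2.1)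
        (by fun_prop)
    · exact (SemiDec.of_re REPred.ratName).comp
        (f := fun z : Word k × (Word k × Word k × Word k) × RatCode × RatCode =>
          (z.2.1.1, z.2.2.1)) (by fun_prop)
    · exact (SemiDec.of_re REPred.ratName).comp
        (f := fun z : Word k × (Word k × Word k × Word k) × RatCode × RatCode =>
          (z.2.1.2.2, z.2.2.2)) (by fun_prop)
    · exact hP.comp
        (f := fun z : Word k × (Word k × Word k × Word k) × RatCode × RatCode =>
          (z.2.1.2.1, z.2.2.1, z.2.2.2)) (by fun_prop)
  obtain ⟨M, hM⟩ := hR.exists_machine_lists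
  refine ⟨M, fun p x hx => ?_⟩
  obtain ⟨q, hq, hl⟩ := hM p
  refine ⟨q, hq, fun u v w => ?_⟩
  rw [hl _ (by simp [wrap_eq])]
  constructor
  · rintro ⟨⟨⟨u', v', w'⟩, a, b⟩, e, hv, hu, hw, hp⟩
    have := tuple_injective e
    simp only [List.cons.injEq, and_true] at this
    obtain ⟨rfl, rfl, rfl⟩ := this
    exact ⟨_, _, _, hu.ratNot, Part.get_mem hv, hw.ratNot, (h p x hx v _ (Part.get_mem hv) a b).1 hp⟩
  · rintro ⟨a, b, R, ha, hR, hb, hlt⟩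
    obtain ⟨s, hs, rfl⟩ := exists_ratName_of_ratNot ha
    obtain ⟨t, ht, rfl⟩ := exists_ratName_of_ratNot hb
    exact ⟨⟨(u, v, w), s, t⟩, rfl, Part.dom_iff_mem.2 ⟨R, hR⟩, hs, ht, (h p x hx v R hR s t).2 hlt⟩

/-! ### The representation `ξ̄_C` -/

/-- Let `j → ∞` in `d(yᵢ, x) ≤ d(yᵢ, yⱼ) + d(yⱼ, x)`. -/
theorem xiBar_approx (hF : ∀ i, μ (F i) < ∞) {p : Seq k} {x : Classes μ} (h : xiBar S μ F p x) :
    ∃ (v : ℕ → Word k) (y : ℕ → Classes μ), EncodesSeq p v ∧ (∀ i, y i ∈ beta S μ (v i)) ∧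
      ∀ i, dbar μ F (y i) x ≤ (2 : ℝ)⁻¹ ^ i := by
  obtain ⟨v, y, hv, hy, hd, ht⟩ := h
  refine ⟨v, y, hv, hy, fun i => ?_⟩
  have h1 : Tendsto (fun j => (2 : ℝ)⁻¹ ^ i + dbar μ F (y j) x) atTop (𝓝 ((2 : ℝ)⁻¹ ^ i + 0)) :=
    tendsto_const_nhds.add ht
  rw [add_zero] at h1
  refine ge_of_tendsto h1 ?_
  filter_upwards [eventually_gt_atTop i] with j hj
  exact (dbar_triangle hF _ (y j) _).trans (by gcongr; exact hd i j hj)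

theorem IsPartition.mem_ring (h : IsPartition S μ F) (i : ℕ) : F i ∈ S.ring := by
  obtain ⟨⟨g, -, hg⟩, -⟩ := h
  exact S.mem_ring_of_mem_nota (hg i)

theorem IsMajorisingPartition.confirmsMeasures_xiBar (hμ : IsComputableMeasure S μ)
    (hF : IsMajorisingPartition S μ F) : ConfirmsMeasures S μ (xiBar S μ F) := by
  obtain ⟨I, hI, hI'⟩ := S.exists_re_inter
  obtain ⟨Lo, hLo, hLo'⟩ := hμ.exists_re_lower
  obtain ⟨Up, hUp, hUp'⟩ := hμ.exists_re_upper
  obtain ⟨⟨-, -, hfin⟩, g', hg', hmaj⟩ := hF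
  -- The witness `((n, l, u), w, c, d)`: `n` is the majorising index, `l` the entries of the name
  -- before entry `u`, whose index is thus `l.length`, `w` a name of the intersection of the two
  -- ring elements, and `c < μ < d` bounds for its measure. The last two conditions leave room for
  -- the error `2^(n+2) / 2^l.length`.
  refine ⟨fun p x => ∃ y : (ℕ × List (Word k) × Word k) × Word k × RatCode × RatCode,
    y.1.1 ∈ g' x.1 ∧ (∃ n, p.take n = tuple (y.1.2.1 ++ [y.1.2.2])) ∧ y.1.1 < y.1.2.1.length ∧
    I ((x.1, y.1.2.2), y.2.1) ∧ Lo (y.2.1, y.2.2.1) ∧ Up (y.2.1, y.2.2.2) ∧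
    (x.2.1.add (RatCode.twoPow (y.1.1 + 2) y.1.2.1.length)).val < y.2.2.1.val ∧
    (y.2.2.2.add (RatCode.twoPow (y.1.1 + 2) y.1.2.1.length)).val < x.2.2.val,
    SemiDec.exists_right (R := fun p (x : Word k × RatCode × RatCode)
      (y : (ℕ × List (Word k) × Word k) × Word k × RatCode × RatCode) =>
    y.1.1 ∈ g' x.1 ∧ (∃ n, p.take n = tuple (y.1.2.1 ++ [y.1.2.2])) ∧ y.1.1 < y.1.2.1.length ∧
    I ((x.1, y.1.2.2), y.2.1) ∧ Lo (y.2.1, y.2.2.1) ∧ Up (y.2.1, y.2.2.2) ∧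
    (x.2.1.add (RatCode.twoPow (y.1.1 + 2) y.1.2.1.length)).val < y.2.2.1.val ∧
    (y.2.2.2.add (RatCode.twoPow (y.1.1 + 2) y.1.2.1.length)).val < x.2.2.val) ?_,
    fun p x hx v R hR a b => ?_⟩
  · let T := (Word k × RatCode × RatCode) ×
      ((ℕ × List (Word k) × Word k) × Word k × RatCode × RatCode)
    refine SemiDec.and ?_ (SemiDec.and ?_ (SemiDec.and ?_ (SemiDec.and ?_ (SemiDec.and ?_
      (SemiDec.and ?_ (SemiDec.and ?_ ?_))))))
    · exact (SemiDec.of_re hg'.graph_re).comp (f := fun z : T => (z.1.1, z.2.1.1)) (by fun_prop)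
    · exact SemiDec.tuple_eq_take.comp (f := fun z : T => z.2.1.2.1 ++ [z.2.1.2.2]) (by fun_prop)
    · exact SemiDec.of_re (REPred.lt (by fun_prop) (by fun_prop))
    · exact (SemiDec.of_re hI).comp
        (f := fun z : T => ((z.1.1, z.2.1.2.2), z.2.2.1)) (by fun_prop)
    · exact (SemiDec.of_re hLo).comp (f := fun z : T => (z.2.2.1, z.2.2.2.1)) (by fun_prop)
    · exact (SemiDec.of_re hUp).comp (f := fun z : T => (z.2.2.1, z.2.2.2.2)) (by fun_prop)
    · exact SemiDec.of_re (REPred.val_lt (by fun_prop) (by fun_prop))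
    · exact SemiDec.of_re (REPred.val_lt (by fun_prop) (by fun_prop))
  · obtain ⟨z, y, hz, hy, hd⟩ := xiBar_approx hfin hx
    obtain ⟨n, hn, hsub⟩ := hmaj v R hR
    have bounds : ∀ j, n < j → ∀ Q, ∀ h : Q ∈ S.nota (z j),
        interMeasure μ R x ≤ μ.real (R ∩ Q) + 2 ^ (n + 2) / 2 ^ j ∧
        μ.real (R ∩ Q) ≤ interMeasure μ R x + 2 ^ (n + 2) / 2 ^ j := by
      intro j hj Q hQ
      obtain ⟨Q', hQ', e⟩ := mem_beta_iff.1 (hy j)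
      obtain rfl : Q = Q' := Part.mem_unique hQ hQ'
      have h1 := hd j
      have h2 := interMeasure_le_add hfin hsub hj h1
      rw [dbar_comm] at h1
      have h3 := interMeasure_le_add hfin hsub hj h1
      rw [e] at h2 h3
      exact ⟨h3, h2⟩
    constructor
    · rintro ⟨⟨⟨n', l, u⟩, w, c, d⟩, hn', hpre, hlt, hw, hc, hd', h1, h2⟩
      obtain rfl : n = n' := Part.mem_unique hn hn'
      have hl := (hz.tuple_eq_take_iff _).1 hpre
      have hu : u = z l.length := by
        have := congrArg (fun l' => l'[l.length]?) hl
        simpa using this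
      subst hu
      obtain ⟨Q, hQ, -⟩ := mem_beta_iff.1 (hy l.length)
      have hwn := (hI' v _ R Q hR hQ).2 w hw
      have hc' := (hLo' w _ hwn c).1 hc
      have hd'' := (hUp' w _ hwn d).1 hd'
      obtain ⟨b1, b2⟩ := bounds l.length hlt Q hQ
      simp only [RatCode.val_add, RatCode.val_twoPow] at h1 h2
      have h1' : (a.val : ℝ) + 2 ^ (n + 2) / 2 ^ l.length < c.val := by
        have := (Rat.cast_lt (K := ℝ)).2 h1
        push_cast at this
        exact this
      have h2' : (d.val : ℝ) + 2 ^ (n + 2) / 2 ^ l.length < b.val := by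
        have := (Rat.cast_lt (K := ℝ)).2 h2
        push_cast at this
        exact this
      constructor <;> linarith
    · rintro ⟨ha, hb⟩
      -- One `ε` absorbs the deviation of `μ(R ∩ Q)` from `μ(R ∩ A)`, the other the same margin
      -- demanded by the test.
      obtain ⟨ε, hε, hεa, hεb⟩ : ∃ ε : ℝ, 0 < ε ∧ a.val + 2 * ε < interMeasure μ R x ∧
          interMeasure μ R x + 2 * ε < b.val := by
        refine ⟨min (interMeasure μ R x - a.val) (b.val - interMeasure μ R x) / 3, ?_, ?_, ?_⟩
        · have := lt_min (sub_pos.2 ha) (sub_pos.2 hb)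
          linarith
        · have := min_le_left (interMeasure μ R x - a.val) (b.val - interMeasure μ R x)
          linarith
        · have := min_le_right (interMeasure μ R x - a.val) (b.val - interMeasure μ R x)
          linarith
      obtain ⟨j, hj, hjε⟩ : ∃ j, n < j ∧ (2 : ℝ) ^ (n + 2) / 2 ^ j < ε := by
        have h1 : Tendsto (fun j : ℕ => (2 : ℝ) ^ (n + 2) * (2⁻¹ : ℝ) ^ j) atTop
            (𝓝 (2 ^ (n + 2) * 0)) :=
          (tendsto_pow_atTop_nhds_zero_of_lt_one (by norm_num) (by norm_num)).const_mul _
        rw [mul_zero] at h1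
        obtain ⟨j, h2, h3⟩ := ((h1.eventually_lt_const hε).and (eventually_gt_atTop n)).exists
        exact ⟨j, h3, by rwa [div_eq_mul_inv, ← inv_pow]⟩
      obtain ⟨Q, hQ, -⟩ := mem_beta_iff.1 (hy j)
      obtain ⟨⟨w, hw⟩, hwn⟩ := hI' v _ R Q hR hQ
      obtain ⟨b1, b2⟩ := bounds j hj Q hQ
      obtain ⟨c, hc1, hc2⟩ := RatCode.exists_between
        (show (a.val : ℝ) + 2 ^ (n + 2) / 2 ^ j < μ.real (R ∩ Q) by linarith)
      obtain ⟨d, hd1, hd2⟩ := RatCode.exists_between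
        (show μ.real (R ∩ Q) < (b.val : ℝ) - 2 ^ (n + 2) / 2 ^ j by linarith)
      have hlen : ((List.range j).map z).length = j := by simp
      refine ⟨⟨⟨n, (List.range j).map z, z j⟩, w, c, d⟩, hn, ?_, ?_, hw,
        (hLo' w _ (hwn w hw) c).2 hc2, (hUp' w _ (hwn w hw) d).2 hd1, ?_, ?_⟩
      · exact (hz.tuple_eq_take_iff _).2 (by simp [List.range_succ])
      · simpa using hj
      · simp only [RatCode.val_add, RatCode.val_twoPow, hlen]
        rw [← Rat.cast_lt (K := ℝ)]
        push_cast
        exact hc1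
      · simp only [RatCode.val_add, RatCode.val_twoPow, hlen]
        have : (d.val : ℝ) + 2 ^ (n + 2) / 2 ^ j < b.val := by linarith
        rw [← Rat.cast_lt (K := ℝ)]
        push_cast
        exact this

/-- Density of the ring makes the search for approximations succeed. Their closeness is tested only
on finitely many `F j`, so no majorising function is needed. -/
theorem ConfirmsMeasures.reducible_xiBar (hμ : IsComputableMeasure S μ)
    (hF : IsPartition S μ F) {δ : Rep k (Classes μ)} (h : ConfirmsMeasures S μ δ) :
    Reducible δ (xiBar S μ F) := by
  obtain ⟨P, hP, h⟩ := h
  obtain ⟨I, hI, hI'⟩ := S.exists_re_inter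
  obtain ⟨D, hD, hD'⟩ := S.exists_re_sdiff
  obtain ⟨Up, hUp, hUp'⟩ := hμ.exists_re_upper
  have hring := hF.mem_ring
  obtain ⟨⟨g, hg, hgF⟩, -, hfin⟩ := hF
  have hg : Comp g := hg
  -- With `V` the candidate, the witness holds names of `F j ∩ V` and `F j \ V`, an upper bound `t₁`
  -- of `μ(F j ∩ V)`, bounds `t₂, t₂'` around `μ(F j ∩ V ∩ A)` and `t₃', t₃` around `μ((F j \ V) ∩
  -- A)`. The last condition `t₁ + t₃ < t₂ + 2^-(i+3)` forces `μ(F j ∩ (V ∆ A)) < 2^-(i+3)`.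
  have hR : SemiDec fun p (x : ℕ × Word k) => (S.nota x.2).Dom ∧ ∀ j < x.1 + 3,
      ∃ y : (Word k × Word k) × RatCode × (RatCode × RatCode) × RatCode × RatCode,
        I ((g j, x.2), y.1.1) ∧ D ((g j, x.2), y.1.2) ∧ Up (y.1.1, y.2.1) ∧
        P p (y.1.1, y.2.2.1.1, y.2.2.1.2) ∧ P p (y.1.2, y.2.2.2.1, y.2.2.2.2) ∧
        (y.2.1.add y.2.2.2.2).val < (y.2.2.1.1.add (RatCode.twoPow 0 (x.1 + 3))).val := by
    refine SemiDec.and ((SemiDec.of_re S.re_dom).comp (f := fun x : ℕ × Word k => x.2)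
      (by fun_prop)) (SemiDec.forall_lt (R := fun p (x : ℕ × Word k) j =>
      ∃ y : (Word k × Word k) × RatCode × (RatCode × RatCode) × RatCode × RatCode,
        I ((g j, x.2), y.1.1) ∧ D ((g j, x.2), y.1.2) ∧ Up (y.1.1, y.2.1) ∧
        P p (y.1.1, y.2.2.1.1, y.2.2.1.2) ∧ P p (y.1.2, y.2.2.2.1, y.2.2.2.2) ∧
        (y.2.1.add y.2.2.2.2).val < (y.2.2.1.1.add (RatCode.twoPow 0 (x.1 + 3))).val)
        (SemiDec.exists_right (R := fun p (x : (ℕ × Word k) × ℕ)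
        (y : (Word k × Word k) × RatCode × (RatCode × RatCode) × RatCode × RatCode) =>
        I ((g x.2, x.1.2), y.1.1) ∧ D ((g x.2, x.1.2), y.1.2) ∧ Up (y.1.1, y.2.1) ∧
        P p (y.1.1, y.2.2.1.1, y.2.2.1.2) ∧ P p (y.1.2, y.2.2.2.1, y.2.2.2.2) ∧
        (y.2.1.add y.2.2.2.2).val < (y.2.2.1.1.add (RatCode.twoPow 0 (x.1.1 + 3))).val) ?_)
        (by fun_prop))
    let T := ((ℕ × Word k) × ℕ) ×
      ((Word k × Word k) × RatCode × (RatCode × RatCode) × RatCode × RatCode)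
    refine SemiDec.and ?_ (SemiDec.and ?_ (SemiDec.and ?_ (SemiDec.and ?_ (SemiDec.and ?_ ?_))))
    · exact (SemiDec.of_re hI).comp
        (f := fun z : T => ((g z.1.2, z.1.1.2), z.2.1.1)) (by fun_prop)
    · exact (SemiDec.of_re hD).comp
        (f := fun z : T => ((g z.1.2, z.1.1.2), z.2.1.2)) (by fun_prop)
    · exact (SemiDec.of_re hUp).comp (f := fun z : T => (z.2.1.1, z.2.2.1)) (by fun_prop)
    · exact hP.comp (f := fun z : T => (z.2.1.1, z.2.2.2.1.1, z.2.2.2.1.2)) (by fun_prop)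
    · exact hP.comp (f := fun z : T => (z.2.1.2, z.2.2.2.2.1, z.2.2.2.2.2)) (by fun_prop)
    · exact SemiDec.of_re (REPred.val_lt (by fun_prop) (by fun_prop))
  have hmeas := fun i => S.measurableSet_of_mem_ring (hring i)
  obtain ⟨M, hM⟩ := hR.exists_machine_choice
  refine ⟨M, fun p x hx => ?_⟩
  obtain ⟨A, rfl⟩ := exists_cls_eq x
  obtain ⟨q, v, hq, hv, hv'⟩ := hM p fun i => by
    obtain ⟨R, hR, hlt⟩ := S.exists_mem_ring_measure_lt hμ.1 hring A.2 (i + 3)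
      (ε := 1 / 2 ^ (i + 3)) (by positivity)
    obtain ⟨v, hv⟩ := (S.mem_ring_iff R).1 hR
    refine ⟨v, Part.dom_iff_mem.2 ⟨R, hv⟩, fun j hj => ?_⟩
    obtain ⟨⟨w, hw⟩, hwn⟩ := hI' (g j) v _ R (hgF j) hv
    obtain ⟨⟨w', hw'⟩, hwn'⟩ := hD' (g j) v _ R (hgF j) hv
    have e := measureReal_inter_symmDiff hfin hmeas ⟨R, S.measurableSet_of_mem_ring hR⟩ A j
    have h1 := hlt j hj
    simp only at e
    set m₁ := μ.real (F j ∩ R)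
    set m₂ := interMeasure μ (F j ∩ R) (cls μ A)
    set m₃ := interMeasure μ (F j \ R) (cls μ A)
    -- A quarter of the gap, because three of the rational bounds each lose up to `ε`.
    obtain ⟨ε, hε, hε'⟩ : ∃ ε : ℝ, 0 < ε ∧ m₁ + m₃ + 3 * ε < m₂ + 1 / 2 ^ (i + 3) :=
      ⟨(m₂ + 1 / 2 ^ (i + 3) - m₁ - m₃) / 4, by linarith, by linarith⟩
    obtain ⟨t₁, h11, h12⟩ := RatCode.exists_between (lt_add_of_pos_right m₁ hε)
    obtain ⟨t₂, h21, h22⟩ := RatCode.exists_between (sub_lt_self m₂ hε)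
    obtain ⟨t₂', h21', -⟩ := RatCode.exists_between (lt_add_of_pos_right m₂ hε)
    obtain ⟨t₃, h31, h32⟩ := RatCode.exists_between (lt_add_of_pos_right m₃ hε)
    obtain ⟨t₃', -, h32'⟩ := RatCode.exists_between (sub_lt_self m₃ hε)
    refine ⟨⟨(w, w'), t₁, (t₂, t₂'), t₃', t₃⟩, hw, hw', (hUp' w _ (hwn w hw) t₁).2 h11,
      (h p _ hx w _ (hwn w hw) t₂ t₂').2 ⟨h22, h21'⟩,
      (h p _ hx w' _ (hwn' w' hw') t₃' t₃).2 ⟨h32', h31⟩, ?_⟩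
    simp only [RatCode.val_add, RatCode.val_twoPow, pow_zero]
    have : (t₁.val : ℝ) + t₃.val < t₂.val + 1 / 2 ^ (i + 3) := by linarith
    rw [← Rat.cast_lt (K := ℝ)]
    push_cast
    exact this
  let y : ℕ → Classes μ := fun i => (beta S μ (v i)).get (hv' i).1
  have hy : ∀ i, y i ∈ beta S μ (v i) := fun i => Part.get_mem _
  -- The extra factor `1/2` makes the distance of two entries at most `2⁻¹ ^ i`.
  have hd : ∀ i, dbar μ F (y i) (cls μ A) ≤ (2 : ℝ)⁻¹ ^ (i + 1) := by
    intro i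
    obtain ⟨R, hR, e⟩ := mem_beta_iff.1 (hy i)
    rw [e]
    refine dbar_le_of_forall_lt fun j hj => ?_
    obtain ⟨⟨⟨w, w'⟩, t₁, ⟨t₂, t₂'⟩, t₃', t₃⟩, hw, hw', h1, h2, h3, hlt⟩ := (hv' i).2 j hj
    have hwn := (hI' (g j) _ _ R (hgF j) hR).2 w hw
    have hwn' := (hD' (g j) _ _ R (hgF j) hR).2 w' hw'
    have e := measureReal_inter_symmDiff hfin hmeas ⟨R, S.measurableSet_of_mem_nota hR⟩ A j
    have h1' := (hUp' w _ hwn t₁).1 h1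
    have h2' := ((h p _ hx w _ hwn t₂ t₂').1 h2).1
    have h3' := ((h p _ hx w' _ hwn' t₃' t₃).1 h3).2
    simp only [RatCode.val_add, RatCode.val_twoPow, pow_zero] at hlt
    have hlt' : (t₁.val : ℝ) + t₃.val < t₂.val + 1 / 2 ^ (i + 3) := by
      have := (Rat.cast_lt (K := ℝ)).2 hlt
      push_cast at this
      exact this
    simp only at e ⊢
    linarith
  refine ⟨q, hq, v, y, hv, hy, fun i j hij => ?_, ?_⟩
  · have h1 := dbar_triangle hfin (y i) (cls μ A) (y j)
    rw [dbar_comm (cls μ A)] at h1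
    have h2 : (2 : ℝ)⁻¹ ^ (j + 1) ≤ 2⁻¹ ^ (i + 1) :=
      pow_le_pow_of_le_one (by norm_num) (by norm_num) (by omega)
    have h3 : (2 : ℝ)⁻¹ ^ (i + 1) + 2⁻¹ ^ (i + 1) = 2⁻¹ ^ i := by ring
    linarith [hd i, hd j]
  · refine squeeze_zero (fun i => dbar_nonneg _ _) hd ?_
    exact (tendsto_pow_atTop_nhds_zero_of_lt_one (by norm_num) (by norm_num)).comp
      (tendsto_add_atTop_nat 1)

end

end TTE

/-! ### Equivalence of the representations -/

theorem corollary6p6 {k : ℕ} {Ω : Type*} [MeasurableSpace Ω]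
    (S : TTE.ComputableSigmaAlgebra k Ω) (μ : Measure Ω) (hμ : TTE.IsComputableMeasure S μ)
    (F : ℕ → Set Ω) (hF : TTE.IsMajorisingPartition S μ F) :
    TTE.IsRepresentation (TTE.zeta S μ) ∧ TTE.IsRepresentation (TTE.xiBar S μ F) ∧
      TTE.Equivalent (TTE.zeta S μ) (TTE.xiBar S μ F) ∧
      ∀ F' : ℕ → Set Ω, TTE.IsMajorisingPartition S μ F' →
        TTE.Equivalent (TTE.xiBar S μ F) (TTE.xiBar S μ F') := by
  have hzx := TTE.confirmsMeasures_zeta.reducible_xiBar hμ hF.1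
  have hxz := (hF.confirmsMeasures_xiBar hμ).reducible_zeta
  refine ⟨⟨fun p x y => TTE.zeta_unique hμ.1, TTE.exists_zeta⟩, ⟨fun p x y hx hy => ?_,
    fun x => ?_⟩, ⟨hzx, hxz⟩, fun F' hF' =>
      ⟨(hF.confirmsMeasures_xiBar hμ).reducible_xiBar hμ hF'.1,
        (hF'.confirmsMeasures_xiBar hμ).reducible_xiBar hμ hF.1⟩⟩
  -- The output of a machine is determined by its input, so both classes share a `ζ`-name.
  · obtain ⟨M, hM⟩ := hxz
    obtain ⟨q, hq, hqx⟩ := hM p x hx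
    obtain ⟨q', hq', hqy⟩ := hM p y hy
    rw [hq.unique hq'] at hqx
    exact TTE.zeta_unique hμ.1 hqx hqy
  · obtain ⟨M, hM⟩ := hzx
    obtain ⟨p, hp⟩ := TTE.exists_zeta (S := S) x
    obtain ⟨q, -, hq⟩ := hM p x hp
    exact ⟨q, hq⟩
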